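/- **Setting.** Let $M=(\mathcal S,\mathcal A,P,r,\gamma)$ be a finite MDP with deterministic reward $r(s,a)$ and $\gamma\in[0,1)$, with a set of terminal states, which are absorbing and have reward $0$; an episode ends when a terminal state is entered. For a stationary stochastic policy $\pi$ let $V^\pi(s)=\sum_{t\ge0}\gamma^t\,\mathbb E_{\pi}[r(s_t,a_t)\mid s_0=s]$, $Q^\pi(s,a)=r(s,a)+\gamma\sum_{s'}P(s'|s,a)V^\pi(s')$, $V^*=\sup_\pi V^\pi$, $Q^*=\sup_\pi Q^\pi$. Let $$Q_{\max}(s,a)=\sup\Big\{\sum_{t\ge0}\gamma^t r(s_t,a_t)\;:\;(s_0,a_0)=(s,a),\ P(s_{t+1}|s_t,a_t)>0\ \ \forall t\Big\}.$$ $M$ is *nearly deterministic with parameter $\mu$* if $Q_{\max}(s,a)\le Q^*(s,a)+\mu$ for all $s,a$. **Tabular GEM.** Start from arbitrary tables $Q^{(1)},Q^{(2)}$. In each episode, $s_0$ is drawn from a fixed initial distribution, actions are drawn from a policy that is $\epsilon$-greedy ($0<\epsilon\le1$) with respect to $Q^{(1)}$ or $Q^{(2)}$ and is fixed during the episode, and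 next states are drawn from $P$. When the episode $(s_0,a_0,r_0),\dots,(s_T,a_T,r_T)$ has ended, its transitions are processed in order $t=0,\dots,T$: with the current tables put, for $j\in\{1,2\}$, $$V^{(j)}_{t,0}=Q^{(j)}(s_t,\tilde a^{(j)}_t),\qquad V^{(j)}_{t,h}=r_t+\gamma V^{(j)}_{t+1,h-1}\ (h>0),\qquad V^{(j)}_{t,h}=0\ \text{ for } t>T,$$ where each $\tilde a^{(j)}_t$ is a maximiser of $Q^{(1)}(s_t,\cdot)$ or of $Q^{(2)}(s_t,\cdot)$; choose $i\in\{1,2\}$ by an independent fair coin; let $h^*\in\arg\max_{h>0}V^{(i)}_{t,h}$ and $R^{(i)}_t=V^{(j)}_{t,h^*}$ with $j\neq i$; and update $Q^{(i)}(s_t,a_t)\leftarrow Q^{(i)}(s_t,a_t)+\alpha\,(R^{(i)}_t-Q^{(i)}(s_t,a_t))$. Choices among ties, and between $Q^{(1)}$ and $Q^{(2)}$ as the greedy reference, are made by any fixed deterministic rules, which may depend on the step number and the current tables. The learning rate $\alpha\in[0,1]$ of the $n$-th transition may depend on the earlier transitions and coins and on the current state and action. Let $\alpha_n(s,a)$ be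 this rate if the $n$-th transition is processed and starts from $(s,a)$, and $0$ otherwise. **Theorem.** Let $M$ be nearly deterministic with parameter $\mu$, and suppose that with probability $1$, for all nonterminal $s$ and all $a$, $\sum_n\alpha_n(s,a)=\infty$ and $\sum_n\alpha_n(s,a)^2<\infty$. Then, with probability $1$, in the limit $$V^{\tilde\pi}(s)\ \ge\ V^*(s)-\frac{2\mu}{1-\gamma}\qquad\text{for all } s\in\mathcal S,$$ in both of the following senses: (a) for all sufficiently large $n$, for every policy $\tilde\pi$ that is greedy with respect to either of the two tables after the first $n$ transitions; (b) for every policy $\tilde\pi$ that is greedy with respect to any limit point $\tilde Q$ of the sequence of values of either table. -/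

import Mathlib

open MeasureTheory Filter

namespace GEM

noncomputable section

open scoped Classical

/-- A finite discounted MDP with deterministic rewards `r s a`. Episodes end on entering a
terminal state; terminal states are absorbing and give no reward. -/
structure EpisodicMDP (S A : Type*) [Fintype S] [Fintype A] where
  P : S → A → S → ℝ
  P_nonneg : ∀ s a t, 0 ≤ P s a t
  P_sum : ∀ s a, ∑ t, P s a t = 1
  r : S → A → ℝ
  γ : ℝ
  γ_nonneg : 0 ≤ γ
  γ_lt_one : γ < 1
  terminal : Set S
  terminal_absorbing : ∀ s ∈ terminal, ∀ a, P s a s = 1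
  terminal_reward : ∀ s ∈ terminal, ∀ a, r s a = 0

/-- A stationary stochastic policy. -/
structure Policy (S A : Type*) [Fintype A] where
  prob : S → A → ℝ
  nonneg : ∀ s a, 0 ≤ prob s a
  sum_one : ∀ s, ∑ a, prob s a = 1

/-- `π` only plays actions that maximise `Q s ·`. -/
def IsGreedy {S A : Type*} [Fintype A] (Q : S → A → ℝ) (π : Policy S A) : Prop :=
  ∀ s a, 0 < π.prob s a → ∀ b, Q s b ≤ Q s a

namespace EpisodicMDP

variable {S A : Type*} [Fintype S] [Fintype A] (M : EpisodicMDP S A)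

/-- The expectation of `r (s_t, a_t)` when `s_0 = s`, actions are drawn from `π` and states
from `P`. -/
def expReward (π : Policy S A) : ℕ → S → ℝ
  | 0, s => ∑ a, π.prob s a * M.r s a
  | t + 1, s => ∑ a, π.prob s a * ∑ u, M.P s a u * expReward π t u

/-- The value function of `π`, the expected discounted sum of rewards. -/
def V (π : Policy S A) (s : S) : ℝ := ∑' t : ℕ, M.γ ^ t * M.expReward π t s

/-- The action-value function of `π`. -/
def Q (π : Policy S A) (s : S) (a : A) : ℝ := M.r s a + M.γ * ∑ u, M.P s a u * M.V π u

/-- The optimal value function. -/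
def Vstar (s : S) : ℝ := ⨆ π : Policy S A, M.V π s

/-- The optimal action-value function. -/
def Qstar (s : S) (a : A) : ℝ := ⨆ π : Policy S A, M.Q π s a

/-- The largest discounted return along a trajectory from `(s, a)` all of whose transitions have
positive probability. -/
def Qmax (s : S) (a : A) : ℝ :=
  sSup {v : ℝ | ∃ (σ : ℕ → S) (β : ℕ → A), σ 0 = s ∧ β 0 = a ∧
    (∀ t, 0 < M.P (σ t) (β t) (σ (t + 1))) ∧ v = ∑' t : ℕ, M.γ ^ t * M.r (σ t) (β t)}

/-- Nearly deterministic with parameter `μ`. -/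
def NearlyDeterministic (μ : ℝ) : Prop := ∀ s a, M.Qmax s a ≤ M.Qstar s a + μ

end EpisodicMDP

/-- The two tables: `false` is the first, `true` the second. -/
abbrev Tables (S A : Type*) := Bool → S → A → ℝ

/-- One step of interaction: the stored transition, and the coin that selects which of the two
tables is updated when this transition is processed. -/
structure Step (S A : Type*) where
  state : S
  action : A
  next : S
  coin : Bool

/-- The free choices in the tabular algorithm. -/
structure Algorithm (S A : Type*) [Fintype S] [Fintype A] where
  /-- The arbitrary initial tables. -/
  init : Tables S A
  /-- The distribution of initial states. -/
  start : S → ℝ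
  start_nonneg : ∀ s, 0 ≤ start s
  start_sum : ∑ s, start s = 1
  /-- The exploration parameter. -/
  ε : ℝ
  ε_pos : 0 < ε
  ε_le_one : ε ≤ 1
  /-- The learning rate for the `n`-th transition; it may depend on the earlier steps and on the
  current state and action. -/
  rate : (n : ℕ) → (Fin n → Step S A) → S → A → ℝ
  rate_nonneg : ∀ n l s a, 0 ≤ rate n l s a
  rate_le_one : ∀ n l s a, rate n l s a ≤ 1
  /-- The greedy action of the behaviour policy of an episode that starts at step `n` with the
  given tables. -/
  greedy : ℕ → Tables S A → S → A
  greedy_spec : ∀ (n : ℕ) (T : Tables S A), ∃ i, ∀ s b, T i s b ≤ T i s (greedy n T s)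
  /-- The action (one for each table) at which the tables are evaluated to bootstrap, in the
  `n`-th update. -/
  boot : ℕ → Tables S A → Bool → S → A
  boot_spec : ∀ (n : ℕ) (T : Tables S A) (j : Bool), ∃ i, ∀ s b, T i s b ≤ T i s (boot n T j s)
  /-- The rule that selects a maximiser over the positive integers, if there is one. -/
  pick : (ℕ → ℝ) → ℕ
  pick_spec : ∀ f : ℕ → ℝ, (∃ h, 0 < h ∧ ∀ k, 0 < k → f k ≤ f h) →
    0 < pick f ∧ ∀ k, 0 < k → f k ≤ f (pick f)

namespace Algorithm

variable {S A : Type*} [Fintype S] [Fintype A] (M : EpisodicMDP S A) (G : Algorithm S A)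

/-- The value `V_{t,h}` of a rollout of length `h` from step `t` along `x`, bootstrapped by table
`T j` at the actions `β`; nothing is collected after the end of the episode. -/
def rollout (T : Tables S A) (β : Bool → S → A) (x : ℕ → Step S A) (j : Bool) : ℕ → ℕ → ℝ
  | 0, t => T j (x t).state (β j (x t).state)
  | h + 1, t => M.r (x t).state (x t).action +
      M.γ * (if (x t).next ∈ M.terminal then 0 else rollout T β x j h (t + 1))

/-- The twin target `R_n^{(i)}`: the rollout length is chosen by table `i`, the value of that
rollout is taken from the other table. -/
def target (T : Tables S A) (x : ℕ → Step S A) (n : ℕ) (i : Bool) : ℝ :=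
  rollout M T (G.boot n T) x (!i)
    (G.pick fun h => rollout M T (G.boot n T) x i h n) n

/-- The episode that contains step `n` comes to an end. -/
def Completed (x : ℕ → Step S A) (n : ℕ) : Prop := ∃ e, n ≤ e ∧ (x e).next ∈ M.terminal

/-- The learning rate used for the `n`-th transition of `x`. -/
def rateAlong (x : ℕ → Step S A) (n : ℕ) : ℝ :=
  G.rate n (fun m => x m) (x n).state (x n).action

/-- The tables after the first `n` transitions along `x` have been processed. The transitions of an
episode are processed in order once the episode has ended, and never if it does not end. -/
def tables (x : ℕ → Step S A) : ℕ → Tables S A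
  | 0 => G.init
  | n + 1 => fun i s a =>
      if Completed M x n ∧ i = (x n).coin ∧ s = (x n).state ∧ a = (x n).action then
        tables x n i s a +
          G.rateAlong x n * (G.target M (tables x n) x n i - tables x n i s a)
      else tables x n i s a

/-- The learning rate `α_n(s,a)` as applied to the entry `(s,a)`: zero unless the `n`-th processed
transition is one from `(s,a)`. -/
def appliedRate (x : ℕ → Step S A) (n : ℕ) (s : S) (a : A) : ℝ :=
  if Completed M x n ∧ s = (x n).state ∧ a = (x n).action then G.rateAlong x n else 0

/-- The first step of the episode that contains step `n`. -/
def episodeStart (x : ℕ → Step S A) : ℕ → ℕ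
  | 0 => 0
  | n + 1 => if (x n).next ∈ M.terminal then n + 1 else episodeStart x n

/-- The distribution of the state of step `n`, given the earlier steps. -/
def stateProb (x : ℕ → Step S A) : ℕ → S → ℝ
  | 0, s => G.start s
  | n + 1, s => if (x n).next ∈ M.terminal then G.start s
      else if s = (x n).next then 1 else 0

/-- The `ε`-greedy behaviour policy in force at step `n`; it is set at the start of the episode. -/
def behaviour (x : ℕ → Step S A) (n : ℕ) (s : S) (a : A) : ℝ :=
  G.ε / (Fintype.card A : ℝ) + (1 - G.ε) *
    (if a = G.greedy (episodeStart M x n) (G.tables M x (episodeStart M x n)) s then 1 else 0)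

/-- `X` has the law of the interaction of the algorithm with `M`: given the first `n` steps, the
state, the action, the next state and the fair coin of step `n` are drawn one after the other.
(All factors on the right depend on `x` only through its steps up to `n`.) -/
structure IsRun {Ω : Type*} [MeasurableSpace Ω] (ℙ : Measure Ω) (X : ℕ → Ω → Step S A) :
    Prop where
  meas : ∀ n y, MeasurableSet {ω | X n ω = y}
  law : ∀ (n : ℕ) (x : ℕ → Step S A),
    ℙ.real {ω | ∀ m, m < n + 1 → X m ω = x m} =
      ℙ.real {ω | ∀ m, m < n → X m ω = x m} *
        (G.stateProb M x n (x n).state *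
          G.behaviour M x n (x n).state (x n).action *
          M.P (x n).state (x n).action (x n).next * (1 / 2))

end Algorithm

end

end GEM

namespace GEM

noncomputable section

open scoped Classical

/-! Almost surely both tables end up, at nonterminal states and up to any `δ > 0`, between `Qstar`
and `Qmax` (`ae_eventually_tables_mem`). Near determinism makes this band at most `μ` wide, so a
greedy action has optimality gap at most `μ + 2 * δ`. Since there are finitely many gaps, a small
`δ` forces gap at most `μ`, and a policy with such actions loses at most `μ / (1 - γ)`
(`le_V_of_isGreedy`).

The band comes from three applications of one-sided stochastic approximation
(`eventually_le_of_contraction`). The tables merge: their difference contracts by `γ`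
(`Close.target_le`), up to the noise of the coin that selects the table. The upper bound is
pathwise: every rollout follows a feasible trajectory, so its value exceeds `Qmax` by at most the
discounted table error, whatever length is selected. For the lower bound, the one-step rollout is
among the candidates, so the mean of the tables dominates one-step Q-learning with slightly reduced
rewards (`lowerIter_le_avg`), which converges up to that reduction.

The delicate point is what the noise is conditioned on. A target uses later steps of its episode, so
the tables are not adapted to the step sequence. The coin noise is therefore conditioned on earlier
steps and on the coin-free remainder of the episode (`code`); the coin is still fair because the
behaviour policy is fixed during an episode. The transition noise appears only in `lowerIter`, which
is adapted to the step sequence. Both noises have convergent sums by the `L²` martingale argument in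
`ae_tendsto_of_summable_sq`. -/

lemma le_iSup_fin {A : Type*} [Finite A] (f : A → ℝ) (a : A) : f a ≤ ⨆ b, f b :=
  le_ciSup (Set.finite_range f).bddAbove a

/-! ### Optimal values and largest feasible returns of the MDP. -/

namespace EpisodicMDP

variable {S A : Type*} [Fintype S] [Fintype A] (M : EpisodicMDP S A)

/-- A bound for the absolute values of the rewards. -/
def rBound : ℝ := ∑ s, ∑ a, |M.r s a|

lemma rBound_nonneg : 0 ≤ M.rBound :=
  Finset.sum_nonneg fun _ _ => Finset.sum_nonneg fun _ _ => abs_nonneg _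

lemma abs_r_le (s : S) (a : A) : |M.r s a| ≤ M.rBound :=
  (Finset.single_le_sum (f := fun a => |M.r s a|) (fun _ _ => abs_nonneg _)
    (Finset.mem_univ a)).trans
  (Finset.single_le_sum (f := fun s => ∑ a, |M.r s a|)
    (fun _ _ => Finset.sum_nonneg fun _ _ => abs_nonneg _) (Finset.mem_univ s))

lemma one_sub_γ_pos : 0 < 1 - M.γ := by linarith [M.γ_lt_one]

lemma P_sum_mono (s : S) (a : A) {f g : S → ℝ} (h : ∀ u, 0 < M.P s a u → f u ≤ g u) :
    ∑ u, M.P s a u * f u ≤ ∑ u, M.P s a u * g u := by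
  refine Finset.sum_le_sum fun u _ => ?_
  rcases (M.P_nonneg s a u).eq_or_lt with h0 | h0
  · simp [← h0]
  · exact mul_le_mul_of_nonneg_left (h u h0) h0.le

lemma P_sum_const (s : S) (a : A) (c : ℝ) : ∑ u, M.P s a u * c = c := by
  rw [← Finset.sum_mul, M.P_sum, one_mul]

lemma P_sum_add_const (s : S) (a : A) (f : S → ℝ) (c : ℝ) :
    ∑ u, M.P s a u * (f u + c) = ∑ u, M.P s a u * f u + c := by
  simp only [mul_add, Finset.sum_add_distrib, P_sum_const]

lemma abs_P_sum_le (s : S) (a : A) {f : S → ℝ} {c : ℝ} (h : ∀ u, |f u| ≤ c) :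
    |∑ u, M.P s a u * f u| ≤ c := by
  rw [abs_le]
  constructor
  · rw [← M.P_sum_const s a (-c)]
    exact M.P_sum_mono s a fun u _ => (abs_le.1 (h u)).1
  · rw [← M.P_sum_const s a c]
    exact M.P_sum_mono s a fun u _ => (abs_le.1 (h u)).2

lemma exists_P_pos (s : S) (a : A) : ∃ u, 0 < M.P s a u := by
  by_contra! h
  have : ∑ u, M.P s a u ≤ 0 := Finset.sum_nonpos fun u _ => h u
  rw [M.P_sum] at this
  linarith

lemma P_terminal_eq {s u : S} (hs : s ∈ M.terminal) {a : A} (hu : 0 < M.P s a u) : u = s := by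
  by_contra hne
  have h1 := M.P_sum s a
  rw [← Finset.add_sum_erase _ _ (Finset.mem_univ s), M.terminal_absorbing s hs a] at h1
  have h2 : M.P s a u ≤ ∑ v ∈ Finset.univ.erase s, M.P s a v :=
    Finset.single_le_sum (f := fun v => M.P s a v) (fun v _ => M.P_nonneg s a v)
      (Finset.mem_erase.2 ⟨hne, Finset.mem_univ u⟩)
  linarith

end EpisodicMDP

namespace Policy

variable {S A : Type*} [Fintype A] (π : Policy S A)

lemma sum_mono (s : S) {f g : A → ℝ} (h : ∀ a, 0 < π.prob s a → f a ≤ g a) :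
    ∑ a, π.prob s a * f a ≤ ∑ a, π.prob s a * g a := by
  refine Finset.sum_le_sum fun u _ => ?_
  rcases (π.nonneg s u).eq_or_lt with h0 | h0
  · simp [← h0]
  · exact mul_le_mul_of_nonneg_left (h u h0) h0.le

lemma sum_const (s : S) (c : ℝ) : ∑ a, π.prob s a * c = c := by
  rw [← Finset.sum_mul, π.sum_one, one_mul]

lemma sum_add_const (s : S) (f : A → ℝ) (c : ℝ) :
    ∑ a, π.prob s a * (f a + c) = ∑ a, π.prob s a * f a + c := by
  simp only [mul_add, Finset.sum_add_distrib, sum_const]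

lemma abs_sum_le (s : S) {f : A → ℝ} {c : ℝ} (h : ∀ a, |f a| ≤ c) :
    |∑ a, π.prob s a * f a| ≤ c := by
  rw [abs_le]
  constructor
  · rw [← π.sum_const s (-c)]
    exact π.sum_mono s fun u _ => (abs_le.1 (h u)).1
  · rw [← π.sum_const s c]
    exact π.sum_mono s fun u _ => (abs_le.1 (h u)).2

/-- The deterministic policy that plays `f s` in state `s`. -/
def ofFun {S A : Type*} [Fintype A] (f : S → A) : Policy S A where
  prob s a := if a = f s then 1 else 0
  nonneg s a := by split_ifs <;> norm_num
  sum_one s := by simp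

lemma sum_ofFun (f : S → A) (s : S) (g : A → ℝ) :
    ∑ a, (ofFun f).prob s a * g a = g (f s) := by
  simp [ofFun]

end Policy

namespace EpisodicMDP

variable {S A : Type*} [Fintype S] [Fintype A] (M : EpisodicMDP S A)

lemma abs_expReward_le (π : Policy S A) (t : ℕ) (s : S) :
    |M.expReward π t s| ≤ M.rBound := by
  induction t generalizing s with
  | zero => exact π.abs_sum_le s fun a => M.abs_r_le s a
  | succ t ih => exact π.abs_sum_le s fun a => M.abs_P_sum_le s a ih

lemma hasSum_geometric_rBound : HasSum (fun t : ℕ => M.γ ^ t * M.rBound)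
    ((1 - M.γ)⁻¹ * M.rBound) :=
  (hasSum_geometric_of_lt_one M.γ_nonneg M.γ_lt_one).mul_right _

lemma abs_pow_mul_le {y : ℝ} (hy : |y| ≤ M.rBound) (t : ℕ) :
    ‖M.γ ^ t * y‖ ≤ M.γ ^ t * M.rBound := by
  rw [Real.norm_eq_abs, abs_mul, abs_of_nonneg (pow_nonneg M.γ_nonneg t)]
  exact mul_le_mul_of_nonneg_left hy (pow_nonneg M.γ_nonneg t)

lemma summable_discounted {f : ℕ → ℝ} (hf : ∀ t, |f t| ≤ M.rBound) :
    Summable fun t => M.γ ^ t * f t :=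
  Summable.of_norm_bounded M.hasSum_geometric_rBound.summable
    fun t => M.abs_pow_mul_le (hf t) t

lemma abs_tsum_discounted_le {f : ℕ → ℝ} (hf : ∀ t, |f t| ≤ M.rBound) :
    |∑' t, M.γ ^ t * f t| ≤ (1 - M.γ)⁻¹ * M.rBound :=
  tsum_of_norm_bounded M.hasSum_geometric_rBound fun t => M.abs_pow_mul_le (hf t) t

lemma tsum_discounted_succ {f : ℕ → ℝ} (hf : ∀ t, |f t| ≤ M.rBound) :
    ∑' t, M.γ ^ t * f t = f 0 + M.γ * ∑' t, M.γ ^ t * f (t + 1) := by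
  rw [(M.summable_discounted hf).tsum_eq_zero_add, ← tsum_mul_left]
  simp only [pow_zero, one_mul, pow_succ]
  congr 2
  ext t
  ring

lemma V_eq (π : Policy S A) (s : S) : M.V π s = ∑ a, π.prob s a * M.Q π s a := by
  have h : HasSum (fun t => M.γ ^ t * M.expReward π (t + 1) s)
      (∑ a, π.prob s a * ∑ u, M.P s a u * M.V π u) := by
    have h1 : HasSum (fun t => ∑ a, π.prob s a * ∑ u, M.P s a u * (M.γ ^ t * M.expReward π t u))
        (∑ a, π.prob s a * ∑ u, M.P s a u * M.V π u) :=
      hasSum_sum fun a _ => HasSum.mul_left _ (hasSum_sum fun u _ => HasSum.mul_left _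
        (M.summable_discounted fun t => M.abs_expReward_le π t u).hasSum)
    convert h1 using 2 with t
    simp only [expReward, Finset.mul_sum]
    refine Finset.sum_congr rfl fun a _ => Finset.sum_congr rfl fun u _ => by ring
  rw [V, M.tsum_discounted_succ fun t => M.abs_expReward_le π t s, h.tsum_eq]
  simp only [expReward, Q, mul_add, Finset.sum_add_distrib]
  congr 1
  rw [Finset.mul_sum]
  exact Finset.sum_congr rfl fun a _ => by ring

/-- Maximum principle: where `W - V` is largest, with value `d`, the two Bellman relations give `d ≤
γ * d + g`. -/
lemma le_V_add (π : Policy S A) (W : S → ℝ) (g : ℝ)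
    (h : ∀ s, W s ≤ ∑ a, π.prob s a * (M.r s a + M.γ * ∑ u, M.P s a u * W u) + g) (s : S) :
    W s ≤ M.V π s + g / (1 - M.γ) := by
  have : Nonempty S := ⟨s⟩
  obtain ⟨s₀, hs₀⟩ := Finite.exists_max fun s => W s - M.V π s
  set d := W s₀ - M.V π s₀ with hd
  have h1 : ∑ a, π.prob s₀ a * (M.r s₀ a + M.γ * ∑ u, M.P s₀ a u * W u) ≤
      M.V π s₀ + M.γ * d := by
    rw [V_eq, ← π.sum_add_const]
    refine π.sum_mono _ fun a _ => ?_
    rw [Q, add_assoc, ← mul_add, ← P_sum_add_const]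
    exact add_le_add le_rfl (mul_le_mul_of_nonneg_left
      (M.P_sum_mono _ _ fun u _ => by linarith [hs₀ u]) M.γ_nonneg)
  have h2 := h s₀
  have h3 : d ≤ g / (1 - M.γ) := by
    rw [le_div_iff₀ M.one_sub_γ_pos]
    nlinarith
  linarith [hs₀ s]

lemma V_le (π : Policy S A) (W : S → ℝ)
    (h : ∀ s, ∑ a, π.prob s a * (M.r s a + M.γ * ∑ u, M.P s a u * W u) ≤ W s) (s : S) :
    M.V π s ≤ W s := by
  have : Nonempty S := ⟨s⟩
  obtain ⟨s₀, hs₀⟩ := Finite.exists_max fun s => M.V π s - W s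
  set d := M.V π s₀ - W s₀ with hd
  have h1 : M.V π s₀ ≤
      ∑ a, π.prob s₀ a * (M.r s₀ a + M.γ * ∑ u, M.P s₀ a u * W u) + M.γ * d := by
    rw [V_eq, ← π.sum_add_const]
    refine π.sum_mono _ fun a _ => ?_
    rw [Q, add_assoc, ← mul_add, ← P_sum_add_const]
    exact add_le_add le_rfl (mul_le_mul_of_nonneg_left
      (M.P_sum_mono _ _ fun u _ => by linarith [hs₀ u]) M.γ_nonneg)
  have h2 := h s₀
  have h3 : d ≤ 0 := by
    have := M.one_sub_γ_pos
    by_contra! hd0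
    nlinarith
  linarith [hs₀ s]

/-- The Bellman optimality operator on action values. -/
def bellman (f : S → A → ℝ) (s : S) (a : A) : ℝ :=
  M.r s a + M.γ * ∑ u, M.P s a u * ⨆ b, f u b

lemma exists_bellman_fixed [Nonempty A] : ∃ q : S → A → ℝ, M.bellman q = q := by
  have hc : ContractingWith ⟨M.γ, M.γ_nonneg⟩ M.bellman := by
    refine ⟨M.γ_lt_one, LipschitzWith.of_dist_le_mul fun f g => ?_⟩
    have hsup : ∀ (f g : S → A → ℝ) u, ⨆ b, f u b ≤ (⨆ b, g u b) + dist f g := by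
      intro f g u
      refine ciSup_le fun b => ?_
      have h1 : |f u b - g u b| ≤ dist f g :=
        (dist_le_pi_dist (f u) (g u) b).trans (dist_le_pi_dist f g u)
      linarith [(abs_le.1 h1).2, le_iSup_fin (g u) b]
    have key : ∀ (f g : S → A → ℝ) s a, M.bellman f s a - M.bellman g s a ≤ M.γ * dist f g := by
      intro f g s a
      have := M.P_sum_mono s a fun u _ => hsup f g u
      rw [P_sum_add_const] at this
      have := mul_le_mul_of_nonneg_left this M.γ_nonneg
      simp only [bellman]
      linarith
    have hnn : 0 ≤ M.γ * dist f g := mul_nonneg M.γ_nonneg dist_nonneg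
    refine (dist_pi_le_iff hnn).2 fun s => (dist_pi_le_iff hnn).2 fun a => ?_
    rw [Real.dist_eq, abs_le]
    have h1 := key f g s a
    have h2 := key g f s a
    rw [dist_comm] at h2
    constructor <;> linarith
  exact ⟨_, hc.fixedPoint_isFixedPt⟩

/-- The fixed point dominates every policy by `V_le`, and the policy greedy for it attains it by
`le_V_add` with zero slack. One policy thus attains all the suprema at once. -/
lemma optimal_of_bellman [Nonempty A] {q : S → A → ℝ} (hq : M.bellman q = q) :
    (∀ s, M.Vstar s = ⨆ b, q s b) ∧ ∀ s a, M.Qstar s a = q s a := by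
  have hq' : ∀ s a, M.r s a + M.γ * ∑ u, M.P s a u * (⨆ b, q u b) = q s a :=
    fun s a => congrFun (congrFun hq s) a
  have hV : ∀ π s, M.V π s ≤ ⨆ b, q s b := by
    intro π
    refine M.V_le π _ fun s => ?_
    simp only [hq']
    refine (π.sum_mono s fun a _ => le_iSup_fin (q s) a).trans_eq (π.sum_const s _)
  choose f hf using fun s => exists_eq_ciSup_of_finite (f := q s)
  have hopt : ∀ s, (⨆ b, q s b) ≤ M.V (Policy.ofFun f) s := by
    intro s
    have := M.le_V_add (Policy.ofFun f) (fun s => ⨆ b, q s b) 0 (fun s => by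
      rw [Policy.sum_ofFun, hq', hf, add_zero]) s
    simpa using this
  have hVeq : ∀ s, M.V (Policy.ofFun f) s = ⨆ b, q s b :=
    fun s => le_antisymm (hV _ s) (hopt s)
  have : Nonempty (Policy S A) := ⟨Policy.ofFun f⟩
  constructor
  · intro s
    refine le_antisymm (ciSup_le fun π => hV π s) ?_
    rw [← hVeq]
    exact le_ciSup (f := fun π => M.V π s) ⟨⨆ b, q s b, by rintro _ ⟨π, rfl⟩; exact hV π s⟩ _
  · intro s a
    have hQ : ∀ π, M.Q π s a ≤ q s a := by
      intro π
      rw [← hq', Q]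
      exact add_le_add le_rfl (mul_le_mul_of_nonneg_left
        (M.P_sum_mono s a fun u _ => hV π u) M.γ_nonneg)
    refine le_antisymm (ciSup_le hQ) ?_
    have : q s a = M.Q (Policy.ofFun f) s a := by
      rw [Q, ← hq']
      simp only [hVeq]
    rw [this]
    exact le_ciSup (f := fun π => M.Q π s a) ⟨q s a, by rintro _ ⟨π, rfl⟩; exact hQ π⟩ _

lemma Vstar_eq [Nonempty A] (s : S) : M.Vstar s = ⨆ b, M.Qstar s b := by
  obtain ⟨q, hq⟩ := M.exists_bellman_fixed
  rw [(M.optimal_of_bellman hq).1]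
  exact iSup_congr fun b => ((M.optimal_of_bellman hq).2 s b).symm

lemma Qstar_eq [Nonempty A] (s : S) (a : A) :
    M.Qstar s a = M.r s a + M.γ * ∑ u, M.P s a u * M.Vstar u := by
  obtain ⟨q, hq⟩ := M.exists_bellman_fixed
  simp only [(M.optimal_of_bellman hq).1, (M.optimal_of_bellman hq).2]
  exact (congrFun (congrFun hq s) a).symm

lemma exists_Qstar_eq_Vstar [Nonempty A] (s : S) : ∃ a, M.Qstar s a = M.Vstar s := by
  rw [Vstar_eq]
  exact exists_eq_ciSup_of_finite

lemma Qstar_terminal [Nonempty A] {s : S} (hs : s ∈ M.terminal) (a : A) :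
    M.Qstar s a = M.γ * M.Vstar s := by
  have h : ∑ u, M.P s a u * M.Vstar u = ∑ u, M.P s a u * M.Vstar s := by
    refine Finset.sum_congr rfl fun u _ => ?_
    rcases (M.P_nonneg s a u).eq_or_lt with h0 | h0
    · simp [← h0]
    · rw [M.P_terminal_eq hs h0]
  rw [Qstar_eq, M.terminal_reward s hs, h, P_sum_const, zero_add]

lemma Vstar_terminal [Nonempty A] {s : S} (hs : s ∈ M.terminal) : M.Vstar s = 0 := by
  obtain ⟨a, ha⟩ := M.exists_Qstar_eq_Vstar s
  rw [M.Qstar_terminal hs] at ha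
  have := M.one_sub_γ_pos
  nlinarith

/-- A policy that plays only actions whose optimality gap is at most `g` loses at most
`g / (1 - γ)`. -/
lemma Vstar_sub_le_V [Nonempty A] (π : Policy S A) (g : ℝ)
    (h : ∀ s a, 0 < π.prob s a → M.Vstar s ≤ M.Qstar s a + g) (s : S) :
    M.Vstar s - g / (1 - M.γ) ≤ M.V π s := by
  have := M.le_V_add π M.Vstar g (fun s => by
    simp only [← Qstar_eq]
    rw [← π.sum_add_const]
    refine (π.sum_const s (M.Vstar s)).symm.trans_le (π.sum_mono s fun a ha => h s a ha)) s
  linarith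

/-- The set of discounted returns along feasible trajectories from `(s, a)`. -/
def returns (s : S) (a : A) : Set ℝ :=
  {v : ℝ | ∃ (σ : ℕ → S) (β : ℕ → A), σ 0 = s ∧ β 0 = a ∧
    (∀ t, 0 < M.P (σ t) (β t) (σ (t + 1))) ∧ v = ∑' t : ℕ, M.γ ^ t * M.r (σ t) (β t)}

lemma bddAbove_returns (s : S) (a : A) : BddAbove (M.returns s a) := by
  refine ⟨(1 - M.γ)⁻¹ * M.rBound, ?_⟩
  rintro v ⟨σ, β, -, -, -, rfl⟩
  exact (abs_le.1 (M.abs_tsum_discounted_le fun t => M.abs_r_le (σ t) (β t))).2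

lemma nonempty_returns (s : S) (a : A) : (M.returns s a).Nonempty := by
  choose nxt hnxt using M.exists_P_pos
  refine ⟨_, fun t => Nat.rec s (fun _ s => nxt s a) t, fun _ => a, rfl, rfl, fun t => ?_, rfl⟩
  exact hnxt _ _

lemma Qmax_terminal_nonneg {s : S} (hs : s ∈ M.terminal) (a : A) : 0 ≤ M.Qmax s a := by
  refine le_csSup (M.bddAbove_returns s a) ⟨fun _ => s, fun _ => a, rfl, rfl, fun t => ?_, ?_⟩
  · rw [M.terminal_absorbing s hs]
    exact one_pos
  · simp [M.terminal_reward s hs]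

/-- A feasible transition put in front of a nearly optimal trajectory from `(u, b)` is a feasible
trajectory from `(s, a)`. This one-sided Bellman relation is all that rollouts need. -/
lemma Qmax_step {s u : S} {a : A} (hu : 0 < M.P s a u) (b : A) :
    M.r s a + M.γ * M.Qmax u b ≤ M.Qmax s a := by
  refine le_of_forall_pos_le_add fun ε hε => ?_
  obtain ⟨v, hv, hlt⟩ := exists_lt_of_lt_csSup (M.nonempty_returns u b)
    (show M.Qmax u b - ε < sSup (M.returns u b) from by
      change sSup (M.returns u b) - ε < _
      linarith)
  obtain ⟨σ, β, h0, hb, hP, rfl⟩ := hv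
  have h1 : M.r s a + M.γ * ∑' t : ℕ, M.γ ^ t * M.r (σ t) (β t) ≤ M.Qmax s a := by
    refine le_csSup (M.bddAbove_returns s a) ⟨fun t => Nat.casesOn t s σ,
      fun t => Nat.casesOn t a β, rfl, rfl, fun t => ?_, ?_⟩
    · cases t with
      | zero => simpa [h0] using hu
      | succ t => exact hP t
    · rw [M.tsum_discounted_succ (f := fun t => M.r (Nat.casesOn t s σ) (Nat.casesOn t a β))
        fun t => M.abs_r_le _ _]
      rfl
  have h2 := mul_le_mul_of_nonneg_left hlt.le M.γ_nonneg
  nlinarith [M.γ_lt_one, M.γ_nonneg]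

/-- Staying in the absorbing state earns nothing, which matches the truncation of rollouts at the
end of an episode. -/
lemma r_le_Qmax_of_terminal [Nonempty A] {s u : S} {a : A} (hu : 0 < M.P s a u)
    (ht : u ∈ M.terminal) : M.r s a ≤ M.Qmax s a := by
  obtain ⟨b⟩ := ‹Nonempty A›
  have := M.Qmax_step hu b
  have := mul_nonneg M.γ_nonneg (M.Qmax_terminal_nonneg ht b)
  linarith

/-- At a pair where the excess `d` of `Qstar` over `Qmax` is largest, averaging `Qmax_step` over the
successors, with their optimal actions, gives `d ≤ γ * d`. -/
lemma Qstar_le_Qmax [Nonempty A] (s : S) (a : A) : M.Qstar s a ≤ M.Qmax s a := by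
  have : Nonempty (S × A) := ⟨(s, a)⟩
  obtain ⟨⟨s₀, a₀⟩, h₀⟩ := Finite.exists_max fun p : S × A => M.Qstar p.1 p.2 - M.Qmax p.1 p.2
  set d := M.Qstar s₀ a₀ - M.Qmax s₀ a₀ with hd
  have h1 : ∑ u, M.P s₀ a₀ u * (M.γ * M.Vstar u) ≤
      ∑ u, M.P s₀ a₀ u * (M.Qmax s₀ a₀ - M.r s₀ a₀ + M.γ * d) := by
    refine M.P_sum_mono _ _ fun u hu => ?_
    obtain ⟨b, hb⟩ := M.exists_Qstar_eq_Vstar u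
    have := M.Qmax_step hu b
    have := mul_le_mul_of_nonneg_left (h₀ (u, b)) M.γ_nonneg
    simp only at this
    rw [← hb]
    linarith
  rw [P_sum_const] at h1
  have h2 : ∑ u, M.P s₀ a₀ u * (M.γ * M.Vstar u) = M.γ * ∑ u, M.P s₀ a₀ u * M.Vstar u := by
    rw [Finset.mul_sum]
    exact Finset.sum_congr rfl fun u _ => by ring
  have h3 := M.Qstar_eq s₀ a₀
  have h4 : d ≤ 0 := by
    have := M.one_sub_γ_pos
    by_contra! hd0
    nlinarith
  linarith [h₀ (s, a)]

lemma NearlyDeterministic.nonneg [Nonempty S] [Nonempty A] {M : EpisodicMDP S A} {μ : ℝ}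
    (h : M.NearlyDeterministic μ) : 0 ≤ μ := by
  obtain ⟨s⟩ := ‹Nonempty S›
  obtain ⟨a⟩ := ‹Nonempty A›
  linarith [h s a, M.Qstar_le_Qmax s a]

end EpisodicMDP

end

end GEM

/-! ### Stochastic approximation and convergence of martingale sums. -/

namespace GEM

/-- A weighted average with non-summable weights tracks the level it is pulled towards. -/
lemma eventually_le_of_pull {v a : ℕ → ℝ} {g : ℝ} (ha0 : ∀ n, 0 ≤ a n) (ha1 : ∀ n, a n ≤ 1)
    (ha : ¬ Summable a) (N : ℕ) (hv : ∀ n, N ≤ n → v (n + 1) ≤ (1 - a n) * v n + a n * g)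
    {δ : ℝ} (hδ : 0 < δ) : ∀ᶠ n in atTop, v n ≤ g + δ := by
  -- The region below `g + δ` is never left once entered; outside it, each step lowers `v` by at
  -- least `a n * δ`, which divergence of the rates does not allow forever.
  have hmono : ∀ n m, N ≤ n → v n ≤ g + δ → v (n + m) ≤ g + δ := by
    intro n m hn h
    induction m with
    | zero => exact h
    | succ m ih =>
      have h1 := hv (n + m) (by omega)
      have := mul_le_mul_of_nonneg_left ih (sub_nonneg.2 (ha1 (n + m)))
      have := mul_nonneg (ha0 (n + m)) hδ.le
      rw [← add_assoc]
      nlinarith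
  by_cases hex : ∃ n, N ≤ n ∧ v n ≤ g + δ
  · obtain ⟨n, hn, h⟩ := hex
    filter_upwards [eventually_ge_atTop n] with k hk
    obtain ⟨m, rfl⟩ := Nat.exists_eq_add_of_le hk
    exact hmono n m hn h
  · exfalso
    push Not at hex
    have hdec : ∀ m, v (N + m) ≤ v N - δ * ∑ k ∈ Finset.range m, a (N + k) := by
      intro m
      induction m with
      | zero => simp
      | succ m ih =>
        have h1 := hv (N + m) (by omega)
        have h2 := hex (N + m) (by omega)
        have := mul_nonneg (ha0 (N + m)) (sub_nonneg.2 h2.le)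
        rw [Finset.sum_range_succ, ← add_assoc]
        nlinarith
    apply ha
    rw [← summable_nat_add_iff N]
    refine summable_of_sum_range_le (c := (v N - g) / δ) (fun n => ha0 _) fun m => ?_
    have h2 := hex (N + m) (by omega)
    rw [le_div_iff₀ hδ]
    simp only [add_comm _ N]
    nlinarith [hdec m]

/-- Asynchronous stochastic approximation of a contraction, one-sided: the noise `w` has
convergent sums, and the drift pulls `u` below `γ c + e` whenever `u` is below `c`. -/
lemma eventually_le_of_contraction {ι : Type*} [Finite ι] {u a w : ℕ → ι → ℝ} {γ e B : ℝ}
    (hγ0 : 0 ≤ γ) (hγ1 : γ < 1) (he : 0 ≤ e)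
    (ha0 : ∀ n i, 0 ≤ a n i) (ha1 : ∀ n i, a n i ≤ 1) (ha : ∀ i, ¬ Summable fun n => a n i)
    (hw : ∀ i, ∃ l, Tendsto (fun n => ∑ k ∈ Finset.range n, w k i) atTop (nhds l))
    (hB : ∀ n i, u n i ≤ B) (N : ℕ)
    (hu : ∀ n, N ≤ n → ∀ c, 0 ≤ c → (∀ j, u n j ≤ c) →
      ∀ i, u (n + 1) i ≤ (1 - a n i) * u n i + a n i * (γ * c + e) + w n i)
    {δ : ℝ} (hδ : 0 < δ) : ∀ᶠ n in atTop, ∀ i, u n i ≤ e / (1 - γ) + δ := by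
  have hγ : 0 < 1 - γ := by linarith
  -- Subtracting the partial noise sums, centred at their limit, leaves a noise-free recursion. The
  -- three `η` pay for the shifted level, for the slack in `eventually_le_of_pull`, and for adding
  -- the noise back.
  have step : ∀ c, 0 ≤ c → (∀ᶠ n in atTop, ∀ i, u n i ≤ c) → ∀ η, 0 < η →
      ∀ᶠ n in atTop, ∀ i, u n i ≤ γ * c + e + 3 * η := by
    intro c hc hev η hη
    rw [eventually_all]
    intro i
    obtain ⟨l, hl⟩ := hw i
    have hcl : ∀ᶠ n in atTop, |∑ k ∈ Finset.range n, w k i - l| < η := by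
      simpa [Real.dist_eq] using (Metric.tendsto_nhds.1 hl) η hη
    obtain ⟨K, hK⟩ := eventually_atTop.1 (hcl.and (hev.and (eventually_ge_atTop N)))
    set s : ℕ → ℝ := fun n => ∑ k ∈ Finset.range n, w k i - l with hs
    have hpull := eventually_le_of_pull (v := fun n => u n i - s n) (a := fun n => a n i)
      (g := γ * c + e + η) (fun n => ha0 n i) (fun n => ha1 n i) (ha i) K (fun n hn => by
        obtain ⟨h1, h2, h3⟩ := hK n hn
        have h4 := hu n h3 c hc h2 i
        have h5 : s (n + 1) = s n + w n i := by
          simp only [hs, Finset.sum_range_succ]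
          ring
        have h6 := mul_le_mul_of_nonneg_left (abs_lt.1 h1).1.le (ha0 n i)
        simp only [h5]
        change a n i * -η ≤ a n i * s n at h6
        nlinarith) hη
    filter_upwards [hpull, hcl] with n h1 h2
    have := (abs_lt.1 h2).2
    simp only [hs] at h1
    linarith
  have hθ : 0 < δ * (1 - γ) / 2 := by positivity
  have iter : ∀ k : ℕ, ∀ᶠ n in atTop, ∀ i, u n i ≤ γ ^ k * |B| + (e / (1 - γ) + δ / 2) := by
    intro k
    -- The slack per round is tuned so that the affine map of bounds has fixed point `e / (1 - γ) +
    -- δ / 2`; the excess over it then shrinks by `γ` in each round.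
    have hfix : γ * (e / (1 - γ) + δ / 2) + e + 3 * (δ * (1 - γ) / 2 / 3) =
        e / (1 - γ) + δ / 2 := by
      field_simp
      ring
    have hb : 0 ≤ e / (1 - γ) + δ / 2 := by positivity
    induction k with
    | zero =>
      refine Eventually.of_forall fun n i => ?_
      have := le_abs_self B
      have := hB n i
      rw [pow_zero, one_mul]
      linarith
    | succ k ih =>
      have hpos : 0 ≤ γ ^ k * |B| := mul_nonneg (pow_nonneg hγ0 k) (abs_nonneg B)
      filter_upwards [step _ (by linarith) ih _ (div_pos hθ three_pos)] with n hn i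
      have := hn i
      rw [pow_succ]
      nlinarith
  have hlim : Tendsto (fun k : ℕ => γ ^ k * |B|) atTop (nhds 0) := by
    simpa using (tendsto_pow_atTop_nhds_zero_of_lt_one hγ0 hγ1).mul_const |B|
  obtain ⟨k, hk⟩ := (hlim.eventually (gt_mem_nhds (half_pos hδ))).exists
  filter_upwards [iter k] with n hn i
  linarith [hn i]

/-- Countably many fibres reduce a zero conditional expectation to vanishing integrals over single
fibres. -/
lemma setIntegral_preimage_eq_zero {Ω β : Type*} [MeasurableSpace Ω] {ℙ : Measure Ω}
    [Countable β] {Z : Ω → β}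
    (hZ : ∀ z, MeasurableSet {ω | Z ω = z}) {f : Ω → ℝ} (hf : Integrable f ℙ)
    (h0 : ∀ z, ∫ ω in {ω | Z ω = z}, f ω ∂ℙ = 0) (B : Set β) : ∫ ω in Z ⁻¹' B, f ω ∂ℙ = 0 := by
  have hU : Z ⁻¹' B = ⋃ z : B, {ω | Z ω = z} := by
    ext ω
    simp
  rw [hU, integral_iUnion (s := fun z : B => {ω | Z ω = (z : β)})
    (fun z => hZ z) ?_ hf.integrableOn]
  · simp [h0]
  · intro z z' hne
    refine Set.disjoint_left.2 fun ω h1 h2 => hne (Subtype.ext ?_)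
    exact (h1 : Z ω = z).symm.trans h2

lemma factors_measurable {Ω β : Type*} {Z : Ω → β} {f : Ω → ℝ}
    (h : ∀ ω ω', Z ω = Z ω' → f ω = f ω') :
    Measurable[MeasurableSpace.comap Z ⊤] f := by
  obtain ⟨g, rfl⟩ : ∃ g : β → ℝ, f = g ∘ Z := by
    have : Function.FactorsThrough f Z := fun ω ω' hω => h ω ω' hω
    exact ⟨Function.extend Z f fun _ => 0, (this.extend_comp fun _ => 0).symm⟩
  let _ : MeasurableSpace β := ⊤
  exact (measurable_from_top (f := g)).comp (comap_measurable Z)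

section Martingale

variable {Ω : Type*} [MeasurableSpace Ω] {ℙ : Measure Ω} [IsProbabilityMeasure ℙ]

lemma measurable_of_countable_fibers {β : Type*} [Countable β] {Z : Ω → β}
    (hZ : ∀ z, MeasurableSet {ω | Z ω = z}) : Measurable[_, ⊤] Z := by
  let _ : MeasurableSpace β := ⊤
  exact measurable_to_countable' hZ

/-- Martingale differences that are square summable along stopped paths have convergent sums.
The filtration is given by countably valued observations `Z n` of increasing precision. -/
lemma ae_tendsto_of_bounded_variance {β : ℕ → Type*} [∀ n, Countable (β n)] {Z : ∀ n, Ω → β n}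
    (hZ : ∀ n z, MeasurableSet {ω | Z n ω = z})
    (hmono : ∀ n ω ω', Z (n + 1) ω = Z (n + 1) ω' → Z n ω = Z n ω')
    {d α : ℕ → Ω → ℝ} {C K : ℝ}
    (hd : ∀ n ω ω', Z (n + 1) ω = Z (n + 1) ω' → d n ω = d n ω')
    (hdα : ∀ n ω, |d n ω| ≤ C * α n ω)
    (hα1 : ∀ n ω, |α n ω| ≤ 1)
    (h0 : ∀ n z, ∫ ω in {ω | Z n ω = z}, d n ω ∂ℙ = 0)
    (hK : ∀ n ω, ∑ k ∈ Finset.range n, α k ω ^ 2 ≤ K) :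
    ∀ᵐ ω ∂ℙ, ∃ l, Tendsto (fun n => ∑ k ∈ Finset.range n, d k ω) atTop (nhds l) := by
  have hmeas : ∀ n, Measurable[_, ⊤] (Z n) := fun n => measurable_of_countable_fibers (hZ n)
  let 𝓕 : Filtration ℕ ‹MeasurableSpace Ω› :=
    { seq := fun n => MeasurableSpace.comap (Z n) ⊤
      mono' := by
        refine monotone_nat_of_le_succ fun n => ?_
        have : Function.FactorsThrough (Z n) (Z (n + 1)) := fun ω ω' hω => hmono n ω ω' hω
        rintro _ ⟨B, -, rfl⟩
        refine ⟨Z (n + 1) '' (Z n ⁻¹' B), trivial, ?_⟩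
        ext ω
        constructor
        · rintro ⟨ω', h1, h2⟩
          rw [Set.mem_preimage, ← hmono n ω' ω h2]
          exact h1
        · intro h
          exact ⟨ω, h, rfl⟩
      le' := fun n => (hmeas n).comap_le }
  set s : ℕ → Ω → ℝ := fun n ω => ∑ k ∈ Finset.range n, d k ω with hs
  have hfac : ∀ n ω ω', Z n ω = Z n ω' → s n ω = s n ω' := by
    intro n
    induction n with
    | zero => intro ω ω' _; simp [hs]
    | succ n ih =>
      intro ω ω' h
      have h1 := ih ω ω' (hmono n _ _ h)
      simp only [hs, Finset.sum_range_succ] at h1 ⊢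
      rw [h1, hd n ω ω' h]
  have hdm : ∀ n, Measurable (d n) := fun n =>
    (factors_measurable (hd n)).mono (hmeas (n + 1)).comap_le le_rfl
  have hsm : ∀ n, Measurable (s n) := fun n =>
    (factors_measurable (hfac n)).mono (hmeas n).comap_le le_rfl
  have hdb : ∀ n ω, |d n ω| ≤ |C| := fun n ω => by
    refine (hdα n ω).trans ((le_abs_self _).trans ?_)
    rw [abs_mul]
    exact mul_le_of_le_one_right (abs_nonneg _) (hα1 n ω)
  have hsb : ∀ n ω, |s n ω| ≤ n * |C| := fun n ω => by
    refine (Finset.abs_sum_le_sum_abs _ _).trans ?_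
    refine (Finset.sum_le_sum fun k _ => hdb k ω).trans ?_
    simp
  have hint : ∀ {f : Ω → ℝ}, Measurable f → (∃ c, ∀ ω, |f ω| ≤ c) → Integrable f ℙ := by
    rintro f hf ⟨c, hc⟩
    exact Integrable.of_bound hf.aestronglyMeasurable c (Eventually.of_forall hc)
  have hdi : ∀ n, Integrable (d n) ℙ := fun n => hint (hdm n) ⟨_, hdb n⟩
  have hsi : ∀ n, Integrable (s n) ℙ := fun n => hint (hsm n) ⟨_, hsb n⟩
  have hsub : Submartingale s 𝓕 ℙ := by
    refine submartingale_of_setIntegral_le_succ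
      (fun n => (factors_measurable (hfac n)).stronglyMeasurable) hsi fun n t ht => ?_
    obtain ⟨B, -, rfl⟩ := ht
    have : s (n + 1) = fun ω => s n ω + d n ω := by
      ext ω
      simp [hs, Finset.sum_range_succ]
    rw [this, integral_add (hsi n).integrableOn (hdi n).integrableOn,
      setIntegral_preimage_eq_zero (hZ n) (hdi n) (h0 n), add_zero]
  have hsdm : ∀ n, Integrable (fun ω => s n ω * d n ω) ℙ := fun n =>
    hint ((hsm n).mul (hdm n)) ⟨n * |C| * |C|, fun ω => by
      rw [abs_mul]
      exact mul_le_mul (hsb n ω) (hdb n ω) (abs_nonneg _) (by positivity)⟩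
  -- The partial sum is constant on each fibre of `Z n` and factors out of the integral.
  -- Orthogonality makes the variances add up.
  have horth : ∀ n, ∫ ω, s n ω * d n ω ∂ℙ = 0 := by
    intro n
    rw [← setIntegral_univ]
    refine setIntegral_preimage_eq_zero (hZ n) (hsdm n) (fun z => ?_) Set.univ
    by_cases hz : ∃ ω₀, Z n ω₀ = z
    · obtain ⟨ω₀, rfl⟩ := hz
      rw [setIntegral_congr_fun (g := fun ω => s n ω₀ * d n ω) (hZ n _) fun ω hω => by
        simp only [hfac n ω ω₀ hω], integral_const_mul, h0, mul_zero]
    · have : {ω | Z n ω = z} = ∅ := by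
        ext ω
        simp only [Set.mem_ofPred_eq, Set.mem_empty_iff_false, iff_false]
        exact fun h => hz ⟨ω, h⟩
      rw [this, setIntegral_empty]
  have hd2i : ∀ n, Integrable (fun ω => d n ω ^ 2) ℙ := fun n =>
    hint ((hdm n).pow_const 2) ⟨|C| ^ 2, fun ω => by
      rw [abs_pow]
      exact pow_le_pow_left₀ (abs_nonneg _) (hdb n ω) 2⟩
  have hs2i : ∀ n, Integrable (fun ω => s n ω ^ 2) ℙ := fun n =>
    hint ((hsm n).pow_const 2) ⟨(n * |C|) ^ 2, fun ω => by
      rw [abs_pow]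
      exact pow_le_pow_left₀ (abs_nonneg _) (hsb n ω) 2⟩
  have hvar : ∀ n, ∫ ω, s n ω ^ 2 ∂ℙ = ∫ ω, ∑ k ∈ Finset.range n, d k ω ^ 2 ∂ℙ := by
    intro n
    induction n with
    | zero => simp [hs]
    | succ n ih =>
      have h1 : (fun ω => s (n + 1) ω ^ 2) =
          fun ω => (s n ω ^ 2 + 2 * (s n ω * d n ω)) + d n ω ^ 2 := by
        ext ω
        simp only [hs, Finset.sum_range_succ]
        ring
      simp only [Finset.sum_range_succ]
      rw [h1, integral_add (f := fun ω => s n ω ^ 2 + 2 * (s n ω * d n ω))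
          ((hs2i n).add ((hsdm n).const_mul 2)) (hd2i n),
        integral_add (hs2i n) ((hsdm n).const_mul 2), integral_const_mul, horth,
        integral_add (integrable_finsetSum _ fun k _ => hd2i k) (hd2i n), ih]
      ring
  have hvarb : ∀ n, ∫ ω, s n ω ^ 2 ∂ℙ ≤ C ^ 2 * K := by
    intro n
    rw [hvar]
    have : ∫ _ω : Ω, C ^ 2 * K ∂ℙ = C ^ 2 * K := by simp
    rw [← this]
    refine integral_mono (integrable_finsetSum _ fun k _ => hd2i k) (integrable_const _)
      fun ω => ?_
    refine le_trans ?_ (mul_le_mul_of_nonneg_left (hK n ω) (sq_nonneg C))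
    rw [Finset.mul_sum]
    refine Finset.sum_le_sum fun k _ => ?_
    rw [← mul_pow, ← sq_abs (d k ω)]
    exact pow_le_pow_left₀ (abs_nonneg _) (hdα k ω) 2
  have hL1 : ∀ n, eLpNorm (s n) 1 ℙ ≤ (C ^ 2 * K + 1).toNNReal := by
    intro n
    rw [eLpNorm_one_eq_lintegral_enorm, ← ofReal_integral_norm_eq_lintegral_enorm (hsi n)]
    refine ENNReal.ofReal_le_ofReal ?_
    refine le_trans (integral_mono (hsi n).norm ((hs2i n).add (integrable_const 1)) fun ω => ?_) ?_
    · simp only [Real.norm_eq_abs, Pi.add_apply]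
      nlinarith [sq_nonneg (|s n ω| - 1), sq_abs (s n ω), abs_nonneg (s n ω)]
    · rw [integral_add' (hs2i n) (integrable_const 1)]
      simpa using hvarb n
  exact hsub.exists_ae_tendsto_of_bdd hL1

/-- Martingale differences dominated by a square summable sequence have convergent sums. -/
lemma ae_tendsto_of_summable_sq {β : ℕ → Type*} [∀ n, Countable (β n)] {Z : ∀ n, Ω → β n}
    (hZ : ∀ n z, MeasurableSet {ω | Z n ω = z})
    (hmono : ∀ n ω ω', Z (n + 1) ω = Z (n + 1) ω' → Z n ω = Z n ω')
    {d α : ℕ → Ω → ℝ} {C : ℝ}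
    (hd : ∀ n ω ω', Z (n + 1) ω = Z (n + 1) ω' → d n ω = d n ω')
    (hα : ∀ n ω ω', Z (n + 1) ω = Z (n + 1) ω' → α n ω = α n ω')
    (hdα : ∀ n ω, |d n ω| ≤ C * α n ω)
    (hα1 : ∀ n ω, |α n ω| ≤ 1)
    (h0 : ∀ n z, ∫ ω in {ω | Z n ω = z}, d n ω ∂ℙ = 0) :
    ∀ᵐ ω ∂ℙ, Summable (fun n => α n ω ^ 2) →
      ∃ l, Tendsto (fun n => ∑ k ∈ Finset.range n, d k ω) atTop (nhds l) := by
  classical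
  have hfac : ∀ n ω ω', Z n ω = Z n ω' →
      ∑ k ∈ Finset.range n, α k ω ^ 2 = ∑ k ∈ Finset.range n, α k ω' ^ 2 := by
    intro n
    induction n with
    | zero => intro ω ω' _; simp
    | succ n ih =>
      intro ω ω' h
      rw [Finset.sum_range_succ, Finset.sum_range_succ, ih ω ω' (hmono n _ _ h), hα n ω ω' h]
  -- Localisation: the test involves only rates before `n`, so it is constant on fibres of `Z n` and
  -- keeps the fibre integrals zero. The last admitted term is at most `1`, hence the bound `K + 1`
  -- below.
  let trunc : ℕ → ℕ → (ℕ → Ω → ℝ) → Ω → ℝ := fun K n f ω =>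
    if ∑ k ∈ Finset.range n, α k ω ^ 2 ≤ K then f n ω else 0
  have hbound : ∀ K n ω, ∑ k ∈ Finset.range n, trunc K k α ω ^ 2 ≤ (K : ℝ) + 1 := by
    intro K n ω
    induction n with
    | zero =>
      simp only [Finset.range_zero, Finset.sum_empty]
      positivity
    | succ n ih =>
      rw [Finset.sum_range_succ]
      by_cases h : ∑ k ∈ Finset.range n, α k ω ^ 2 ≤ K
      · have h1 : ∑ k ∈ Finset.range n, trunc K k α ω ^ 2 ≤ ∑ k ∈ Finset.range n, α k ω ^ 2 := by
          refine Finset.sum_le_sum fun k _ => ?_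
          simp only [trunc]
          split_ifs
          · exact le_rfl
          · simpa using sq_nonneg _
        have h2 : trunc K n α ω ^ 2 ≤ 1 := by
          simp only [trunc, if_pos h]
          rw [← sq_abs]
          exact pow_le_one₀ (abs_nonneg _) (hα1 n ω)
        linarith
      · simpa [trunc, if_neg h] using ih
  have hall : ∀ᵐ ω ∂ℙ, ∀ K : ℕ, ∃ l,
      Tendsto (fun n => ∑ k ∈ Finset.range n, trunc K k d ω) atTop (nhds l) := by
    refine ae_all_iff.2 fun K => ?_
    refine ae_tendsto_of_bounded_variance (α := fun n => trunc K n α) (C := C) (K := K + 1) hZ hmono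
      ?_ ?_ ?_ ?_ (hbound K)
    · intro n ω ω' h
      simp only [trunc, hfac n ω ω' (hmono n _ _ h), hd n ω ω' h]
    · intro n ω
      simp only [trunc]
      split_ifs
      · exact hdα n ω
      · simp
    · intro n ω
      simp only [trunc]
      split_ifs
      · exact hα1 n ω
      · simp
    · intro n z
      by_cases hz : ∃ ω₀, Z n ω₀ = z
      · obtain ⟨ω₀, rfl⟩ := hz
        by_cases hle : ∑ k ∈ Finset.range n, α k ω₀ ^ 2 ≤ K
        · rw [setIntegral_congr_fun (g := d n) (hZ n _) fun ω hω => by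
            simp only [trunc, hfac n ω ω₀ hω, if_pos hle], h0]
        · rw [setIntegral_congr_fun (g := fun _ => (0 : ℝ)) (hZ n _) fun ω hω => by
            simp only [trunc, hfac n ω ω₀ hω, if_neg hle], integral_zero]
      · have : {ω | Z n ω = z} = ∅ := by
          ext ω
          simp only [Set.mem_ofPred_eq, Set.mem_empty_iff_false, iff_false]
          exact fun h => hz ⟨ω, h⟩
        rw [this, setIntegral_empty]
  filter_upwards [hall] with ω hω hsum
  -- For `K` above the total sum of squares, this path is never truncated.
  obtain ⟨K, hK⟩ := exists_nat_ge (∑' n, α n ω ^ 2)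
  obtain ⟨l, hl⟩ := hω K
  refine ⟨l, hl.congr fun n => Finset.sum_congr rfl fun k _ => ?_⟩
  exact if_pos ((hsum.sum_le_tsum _ fun _ _ => sq_nonneg _).trans hK)

end Martingale

end GEM

/-! ### Pathwise analysis of the tables: merging, upper bound, lower bound. -/

namespace GEM

noncomputable section

open scoped Classical

namespace Algorithm

variable {S A : Type*} [Fintype S] [Fintype A] (M : EpisodicMDP S A) (G : Algorithm S A)

/-- A path whose episodes all end and whose steps fit together and have positive probability. -/
structure Regular (x : ℕ → Step S A) : Prop where
  completed : ∀ n, Completed M x n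
  feasible : ∀ n, 0 < M.P (x n).state (x n).action (x n).next
  linked : ∀ n, (x n).next ∉ M.terminal → (x (n + 1)).state = (x n).next

/-- A bound for the absolute values of all table entries. -/
def tableBound : ℝ := ∑ i, ∑ s, ∑ a, |G.init i s a| + (M.rBound + 1) / (1 - M.γ)

lemma sum_abs_init_nonneg : 0 ≤ ∑ i, ∑ s, ∑ a, |G.init i s a| :=
  Finset.sum_nonneg fun _ _ => Finset.sum_nonneg fun _ _ => Finset.sum_nonneg fun _ _ =>
    abs_nonneg _

lemma tableBound_nonneg : 0 ≤ G.tableBound M :=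
  add_nonneg G.sum_abs_init_nonneg (div_nonneg (by linarith [M.rBound_nonneg])
    M.one_sub_γ_pos.le)

/-- The summand `1` leaves room for the reward reduction of at most `1` in `lowerIter`, so that the
same bound serves both recursions. -/
lemma rBound_add_le_tableBound : M.rBound + 1 + M.γ * G.tableBound M ≤ G.tableBound M := by
  have h := mul_div_cancel₀ (M.rBound + 1) M.one_sub_γ_pos.ne'
  have h1 := mul_nonneg G.sum_abs_init_nonneg M.one_sub_γ_pos.le
  rw [tableBound]
  nlinarith

lemma abs_init_le (i : Bool) (s : S) (a : A) : |G.init i s a| ≤ G.tableBound M := by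
  have h1 : |G.init i s a| ≤ ∑ i, ∑ s, ∑ a, |G.init i s a| :=
    ((Finset.single_le_sum (f := fun a => |G.init i s a|) (fun _ _ => abs_nonneg _)
      (Finset.mem_univ a)).trans
    (Finset.single_le_sum (f := fun s => ∑ a, |G.init i s a|)
      (fun _ _ => Finset.sum_nonneg fun _ _ => abs_nonneg _) (Finset.mem_univ s))).trans
    (Finset.single_le_sum (f := fun i => ∑ s, ∑ a, |G.init i s a|)
      (fun _ _ => Finset.sum_nonneg fun _ _ => Finset.sum_nonneg fun _ _ => abs_nonneg _)
      (Finset.mem_univ i))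
  have h2 : 0 ≤ (M.rBound + 1) / (1 - M.γ) :=
    div_nonneg (by linarith [M.rBound_nonneg]) M.one_sub_γ_pos.le
  rw [tableBound]
  linarith

lemma abs_r_add_le {y : ℝ} (hy : |y| ≤ G.tableBound M) (s : S) (a : A) :
    |M.r s a + M.γ * y| ≤ G.tableBound M := by
  have h1 := M.abs_r_le s a
  have h2 : |M.γ * y| ≤ M.γ * G.tableBound M := by
    rw [abs_mul, abs_of_nonneg M.γ_nonneg]
    exact mul_le_mul_of_nonneg_left hy M.γ_nonneg
  linarith [abs_add_le (M.r s a) (M.γ * y), G.rBound_add_le_tableBound M]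

lemma abs_rollout_le {T : Tables S A} (hT : ∀ i s a, |T i s a| ≤ G.tableBound M)
    (β : Bool → S → A) (x : ℕ → Step S A) (j : Bool) (h t : ℕ) :
    |rollout M T β x j h t| ≤ G.tableBound M := by
  induction h generalizing t with
  | zero => exact hT _ _ _
  | succ h ih =>
    refine G.abs_r_add_le M ?_ _ _
    split_ifs
    · simpa using G.tableBound_nonneg M
    · exact ih _

lemma abs_target_le {T : Tables S A} (hT : ∀ i s a, |T i s a| ≤ G.tableBound M)
    (x : ℕ → Step S A) (n : ℕ) (i : Bool) : |G.target M T x n i| ≤ G.tableBound M :=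
  G.abs_rollout_le M hT _ _ _ _ _

lemma rateAlong_nonneg (x : ℕ → Step S A) (n : ℕ) : 0 ≤ G.rateAlong x n := G.rate_nonneg _ _ _ _

lemma rateAlong_le_one (x : ℕ → Step S A) (n : ℕ) : G.rateAlong x n ≤ 1 := G.rate_le_one _ _ _ _

lemma appliedRate_nonneg (x : ℕ → Step S A) (n : ℕ) (s : S) (a : A) :
    0 ≤ G.appliedRate M x n s a := by
  rw [appliedRate]
  split_ifs
  exacts [G.rateAlong_nonneg x n, le_rfl]

lemma appliedRate_le_one (x : ℕ → Step S A) (n : ℕ) (s : S) (a : A) :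
    G.appliedRate M x n s a ≤ 1 := by
  rw [appliedRate]
  split_ifs
  exacts [G.rateAlong_le_one x n, zero_le_one]

/-- Bounds on the target are available only at the pair visited in step `n`; elsewhere the rate is
zero. -/
lemma appliedRate_mul_le {x : ℕ → Step S A} {n : ℕ} {s : S} {a : A} {y z : ℝ}
    (h : s = (x n).state → a = (x n).action → y ≤ z) :
    G.appliedRate M x n s a * y ≤ G.appliedRate M x n s a * z := by
  rw [appliedRate]
  split_ifs with hc
  · exact mul_le_mul_of_nonneg_left (h hc.2.1 hc.2.2) (G.rateAlong_nonneg x n)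
  · simp

lemma tables_succ (x : ℕ → Step S A) (n : ℕ) (i : Bool) (s : S) (a : A) :
    G.tables M x (n + 1) i s a = G.tables M x n i s a +
      (if i = (x n).coin then G.appliedRate M x n s a else 0) *
        (G.target M (G.tables M x n) x n i - G.tables M x n i s a) := by
  simp only [tables, appliedRate]
  split_ifs <;> first | rfl | (simp; done) | tauto

lemma abs_add_mul_sub_le {y z p C : ℝ} (hp0 : 0 ≤ p) (hp1 : p ≤ 1) (hy : |y| ≤ C) (hz : |z| ≤ C) :
    |y + p * (z - y)| ≤ C := by
  rw [abs_le] at *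
  constructor <;> nlinarith

lemma abs_tables_le (x : ℕ → Step S A) (n : ℕ) (i : Bool) (s : S) (a : A) :
    |G.tables M x n i s a| ≤ G.tableBound M := by
  induction n generalizing i s a with
  | zero => exact G.abs_init_le M i s a
  | succ n ih =>
    rw [tables_succ]
    refine abs_add_mul_sub_le ?_ ?_ (ih i s a) (G.abs_target_le M ih x n i)
    · split_ifs
      exacts [G.appliedRate_nonneg M x n s a, le_rfl]
    · split_ifs
      exacts [G.appliedRate_le_one M x n s a, zero_le_one]

lemma rollout_add_eq (T : Tables S A) (β : Bool → S → A) (x : ℕ → Step S A) (j : Bool)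
    (k h t : ℕ) (hk : (x (t + k)).next ∈ M.terminal) :
    rollout M T β x j (k + h + 1) t = rollout M T β x j (k + 1) t := by
  induction k generalizing t with
  | zero => simp only [rollout, if_pos (show (x t).next ∈ M.terminal from hk)]
  | succ k ih =>
    have := ih (t + 1) (by rwa [add_assoc, add_comm 1 k])
    rw [show k + 1 + h + 1 = (k + h + 1) + 1 by omega]
    simp only [rollout] at this ⊢
    rw [this]

/-- Rollouts reaching past the end of the episode all have the same value, so the maximum over
positive lengths is one over a finite set and exists. -/
lemma pick_spec_of_completed {x : ℕ → Step S A} {n : ℕ} (hn : Completed M x n) (T : Tables S A)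
    (i : Bool) :
    ∃ h, G.pick (fun h => rollout M T (G.boot n T) x i h n) = h + 1 ∧
      ∀ k, rollout M T (G.boot n T) x i (k + 1) n ≤ rollout M T (G.boot n T) x i (h + 1) n := by
  obtain ⟨e, hne, he⟩ := hn
  obtain ⟨d, rfl⟩ := Nat.exists_eq_add_of_le hne
  set f : ℕ → ℝ := fun h => rollout M T (G.boot n T) x i h n with hf
  have hmax : ∃ h, 0 < h ∧ ∀ k, 0 < k → f k ≤ f h := by
    obtain ⟨m, -, hm⟩ := Finset.exists_max_image (Finset.range (d + 1)) (fun k => f (k + 1))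
      ⟨0, by simp⟩
    refine ⟨m + 1, Nat.succ_pos m, fun k hk => ?_⟩
    obtain ⟨k, rfl⟩ := Nat.exists_eq_succ_of_ne_zero hk.ne'
    rcases le_or_gt k d with hkd | hkd
    · exact hm k (Finset.mem_range.2 (by omega))
    · obtain ⟨j, rfl⟩ := Nat.exists_eq_add_of_le hkd.le
      have h1 : f (d + j).succ = f (d + 1) := rollout_add_eq M T _ x i d j n he
      rw [h1]
      exact hm d (Finset.mem_range.2 (by omega))
  obtain ⟨h1, h2⟩ := G.pick_spec f hmax
  obtain ⟨h, hh⟩ := Nat.exists_eq_succ_of_ne_zero h1.ne'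
  rw [hh] at h2
  exact ⟨h, hh, fun k => h2 _ (Nat.succ_pos k)⟩

section Close

variable {M} {T : Tables S A} {D : ℝ}

/-- The two tables differ by at most `D` at nonterminal states. -/
def Close (M : EpisodicMDP S A) (T : Tables S A) (D : ℝ) : Prop :=
  0 ≤ D ∧ ∀ s, s ∉ M.terminal → ∀ a, |T false s a - T true s a| ≤ D

lemma Close.le (hT : Close M T D) {s : S} (hs : s ∉ M.terminal) (i j : Bool) (a : A) :
    T i s a ≤ T j s a + D := by
  have h := abs_le.1 (hT.2 s hs a)
  have := hT.1
  cases i <;> cases j <;> linarith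

/-- For `j ≠ k`, the action chosen for `k` maximises one of the two tables; comparing the two
actions within that table means that tables are switched only once. A loss of `2 * D` here would
ruin the contraction factor `γ`. -/
lemma Close.boot_le (hT : Close M T D) {s : S} (hs : s ∉ M.terminal) (n : ℕ) (j k : Bool) :
    T j s (G.boot n T j s) ≤ T k s (G.boot n T k s) + D := by
  obtain ⟨i, hi⟩ := G.boot_spec n T k
  have h1 := hi s (G.boot n T j s)
  have h2 := hT.le hs j k (G.boot n T j s)
  have h3 := hT.le hs j k (G.boot n T k s)
  have h4 := hT.1
  by_cases hjk : j = k
  · subst hjk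
    linarith
  · rcases (show i = j ∨ i = k by revert hjk; cases i <;> cases j <;> cases k <;> simp) with h | h
    · rw [h] at h1
      linarith
    · rw [h] at h1
      linarith

lemma Close.le_boot (hT : Close M T D) {s : S} (hs : s ∉ M.terminal) (n : ℕ) (j k : Bool)
    (b : A) : T k s b ≤ T j s (G.boot n T j s) + 2 * D := by
  obtain ⟨i, hi⟩ := G.boot_spec n T j
  linarith [hi s b, hT.le hs k i b, hT.le hs i j (G.boot n T j s)]

variable {x : ℕ → Step S A} (hx : Regular M x)
include hx

lemma Close.rollout_le (hT : Close M T D) (n h t : ℕ) (j k : Bool)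
    (ht : (x t).state ∉ M.terminal) :
    rollout M T (G.boot n T) x j h t ≤ rollout M T (G.boot n T) x k h t + D := by
  induction h generalizing t with
  | zero => exact hT.boot_le G ht n j k
  | succ h ih =>
    have h0 := hT.1
    simp only [rollout]
    split_ifs with hterm
    · linarith
    · have h1 := mul_le_mul_of_nonneg_left (ih (t + 1) (by rwa [hx.linked t hterm])) M.γ_nonneg
      nlinarith [M.γ_lt_one]

/-- The first reward is common to both tables, so the discrepancy is discounted once. This is where
the restriction to positive lengths matters. -/
lemma Close.rollout_succ_le (hT : Close M T D) (n h t : ℕ) (j k : Bool) :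
    rollout M T (G.boot n T) x j (h + 1) t ≤
      rollout M T (G.boot n T) x k (h + 1) t + M.γ * D := by
  simp only [rollout]
  split_ifs with hterm
  · nlinarith [hT.1, M.γ_nonneg]
  · have h1 := mul_le_mul_of_nonneg_left
      (hT.rollout_le G hx n h (t + 1) j k (by rwa [hx.linked t hterm])) M.γ_nonneg
    linarith

/-- Both lengths are first compared under table `!i`, where the length behind the other target is
maximal; this costs nothing. Only the subsequent change of table, at that fixed length, costs `γ *
D`. -/
lemma Close.target_le (hT : Close M T D) (n : ℕ) (i : Bool) :
    G.target M T x n i ≤ G.target M T x n (!i) + M.γ * D := by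
  obtain ⟨h, hh, -⟩ := G.pick_spec_of_completed M (hx.completed n) T i
  obtain ⟨k, hk, hmax⟩ := G.pick_spec_of_completed M (hx.completed n) T (!i)
  simp only [target, hh, hk, Bool.not_not]
  linarith [hmax h, hT.rollout_succ_le G hx n k n (!i) i]

/-- Length one competes in the maximum taken under table `i`; evaluating the winner with the other
table costs `γ * D`. -/
lemma Close.le_target (hT : Close M T D) (n : ℕ) (i : Bool) :
    M.r (x n).state (x n).action + M.γ * (if (x n).next ∈ M.terminal then 0 else
      T i (x n).next (G.boot n T i (x n).next)) - M.γ * D ≤ G.target M T x n i := by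
  obtain ⟨h, hh, hmax⟩ := G.pick_spec_of_completed M (hx.completed n) T i
  have h1 := hmax 0
  have h2 := hT.rollout_succ_le G hx n h n i (!i)
  simp only [target, hh]
  refine le_trans ?_ (sub_le_iff_le_add.2 (h1.trans h2))
  simp only [rollout]
  split_ifs with hterm
  · exact le_rfl
  · rw [hx.linked n hterm]

/-- Induction along the recorded path with `Qmax_step`, without any expectation. The action `b` is
existential because a rollout of length zero is evaluated at the bootstrap action instead of the
recorded one. -/
lemma rollout_le_Qmax [Nonempty A] {c : ℝ} (hc : 0 ≤ c)
    (hT : ∀ s, s ∉ M.terminal → ∀ i b, T i s b ≤ M.Qmax s b + c) (β : Bool → S → A) (j : Bool)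
    (h t : ℕ) (ht : h = 0 → (x t).state ∉ M.terminal) :
    ∃ b, (0 < h → b = (x t).action) ∧
      rollout M T β x j h t ≤ M.Qmax (x t).state b + (if h = 0 then 1 else M.γ) * c := by
  induction h generalizing t with
  | zero => exact ⟨β j (x t).state, by simp, by simpa [rollout] using hT _ (ht rfl) j _⟩
  | succ h ih =>
    refine ⟨(x t).action, fun _ => rfl, ?_⟩
    simp only [rollout, if_neg (Nat.succ_ne_zero h)]
    have hγc := mul_nonneg M.γ_nonneg hc
    split_ifs with hterm
    · have := M.r_le_Qmax_of_terminal (hx.feasible t) hterm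
      linarith
    · have hl := hx.linked t hterm
      obtain ⟨b, -, hb⟩ := ih (t + 1) (fun _ => by rwa [hl])
      have h1 := M.Qmax_step (hx.feasible t) b
      rw [hl] at hb
      have h2 : (if h = 0 then 1 else M.γ) * c ≤ c := by
        split_ifs
        · linarith
        · nlinarith [M.γ_lt_one]
      have h3 := mul_le_mul_of_nonneg_left (hb.trans (add_le_add le_rfl h2)) M.γ_nonneg
      linarith

lemma target_le_Qmax [Nonempty A] {c : ℝ} (hc : 0 ≤ c)
    (hT : ∀ s, s ∉ M.terminal → ∀ i b, T i s b ≤ M.Qmax s b + c) (n : ℕ) (i : Bool) :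
    G.target M T x n i ≤ M.Qmax (x n).state (x n).action + M.γ * c := by
  obtain ⟨h, hh, -⟩ := G.pick_spec_of_completed M (hx.completed n) T i
  simp only [target, hh]
  obtain ⟨b, hb, hle⟩ := rollout_le_Qmax hx hc hT (G.boot n T) (!i) (h + 1) n (by simp)
  rw [hb (Nat.succ_pos h), if_neg (Nat.succ_ne_zero h)] at hle
  exact hle

end Close

/-- The mean of the two tables. -/
def avg (x : ℕ → Step S A) (n : ℕ) (s : S) (a : A) : ℝ :=
  (G.tables M x n false s a + G.tables M x n true s a) / 2

/-- The difference of the two tables. -/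
def diff (x : ℕ → Step S A) (n : ℕ) (s : S) (a : A) : ℝ :=
  G.tables M x n false s a - G.tables M x n true s a

/-- The sum of the two temporal differences, the scale of the noise from the coin. -/
def surprise (x : ℕ → Step S A) (n : ℕ) (s : S) (a : A) : ℝ :=
  G.target M (G.tables M x n) x n false - G.tables M x n false s a +
    (G.target M (G.tables M x n) x n true - G.tables M x n true s a)

/-- The part of the change of `diff` that is due to the coin. -/
def coinNoise (x : ℕ → Step S A) (n : ℕ) (s : S) (a : A) : ℝ :=
  (if (x n).coin then -1 else 1) * (G.appliedRate M x n s a / 2 * G.surprise M x n s a)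

lemma abs_surprise_le (x : ℕ → Step S A) (n : ℕ) (s : S) (a : A) :
    |G.surprise M x n s a| ≤ 4 * G.tableBound M := by
  have h1 := abs_le.1 (G.abs_target_le M (G.abs_tables_le M x n) x n false)
  have h2 := abs_le.1 (G.abs_target_le M (G.abs_tables_le M x n) x n true)
  have h3 := abs_le.1 (G.abs_tables_le M x n false s a)
  have h4 := abs_le.1 (G.abs_tables_le M x n true s a)
  rw [surprise, abs_le]
  constructor <;> linarith

/-- The coin indicator is replaced by its mean `1 / 2`; the remainder is a random sign times a
quantity that does not involve the coin of step `n`. -/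
lemma diff_succ (x : ℕ → Step S A) (n : ℕ) (s : S) (a : A) :
    G.diff M x (n + 1) s a = (1 - G.appliedRate M x n s a / 2) * G.diff M x n s a +
      G.appliedRate M x n s a / 2 * (G.target M (G.tables M x n) x n false -
        G.target M (G.tables M x n) x n true) + G.coinNoise M x n s a := by
  simp only [diff, coinNoise, surprise, tables_succ]
  cases (x n).coin <;> simp <;> ring

/-- Whichever table the coin selects, the mean moves at half the rate; once the tables are close, no
coin noise has to be split off. -/
lemma avg_succ (x : ℕ → Step S A) (n : ℕ) (s : S) (a : A) :
    G.avg M x (n + 1) s a = G.avg M x n s a + G.appliedRate M x n s a / 2 *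
      (G.target M (G.tables M x n) x n (x n).coin - G.tables M x n (x n).coin s a) := by
  simp only [avg, tables_succ]
  cases (x n).coin <;> simp <;> ring

/-- The learning rates fulfil the first of the conditions of Robbins and Monro. -/
def Exploring (x : ℕ → Step S A) : Prop :=
  ∀ s, s ∉ M.terminal → ∀ a, ¬ Summable fun n => G.appliedRate M x n s a

variable {M}

lemma not_summable_half {f : ℕ → ℝ} (h : ¬ Summable f) : ¬ Summable fun n => f n / 2 := by
  intro h'
  exact h ((h'.mul_right 2).congr fun n => by ring)

/-- The two tables approach each other. -/
lemma eventually_close {x : ℕ → Step S A} (hx : Regular M x) (hr : G.Exploring M x)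
    (hnoise : ∀ s, s ∉ M.terminal → ∀ a, ∃ l,
      Tendsto (fun n => ∑ k ∈ Finset.range n, G.coinNoise M x k s a) atTop (nhds l))
    {δ : ℝ} (hδ : 0 < δ) : ∀ᶠ n in atTop, Close M (G.tables M x n) δ := by
  let sgn : Bool → ℝ := fun b => if b then -1 else 1
  have hsgn : ∀ b y, sgn b * y ≤ |y| := by
    intro b y
    cases b
    · simpa [sgn] using le_abs_self y
    · simpa [sgn] using neg_le_abs y
  -- The extra Boolean index carries a sign, so that the one-sided lemma bounds the absolute
  -- difference.
  have key := eventually_le_of_contraction (ι := Bool × {s // s ∉ M.terminal} × A)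
    (u := fun n p => sgn p.1 * G.diff M x n p.2.1 p.2.2)
    (a := fun n p => G.appliedRate M x n p.2.1 p.2.2 / 2)
    (w := fun n p => sgn p.1 * G.coinNoise M x n p.2.1 p.2.2)
    (γ := M.γ) (e := 0) (B := 2 * G.tableBound M)
    M.γ_nonneg M.γ_lt_one le_rfl
    (fun n p => by linarith [G.appliedRate_nonneg M x n p.2.1 p.2.2])
    (fun n p => by linarith [G.appliedRate_le_one M x n p.2.1 p.2.2])
    (fun p => not_summable_half (hr p.2.1 p.2.1.2 p.2.2))
    (fun p => by
      obtain ⟨l, hl⟩ := hnoise p.2.1 p.2.1.2 p.2.2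
      refine ⟨sgn p.1 * l, ?_⟩
      simpa only [Finset.mul_sum] using hl.const_mul (sgn p.1))
    (fun n p => by
      refine (hsgn _ _).trans ?_
      have h3 := abs_le.1 (G.abs_tables_le M x n false p.2.1 p.2.2)
      have h4 := abs_le.1 (G.abs_tables_le M x n true p.2.1 p.2.2)
      rw [diff, abs_le]
      constructor <;> linarith)
    0 (fun n _ c hc hj p => by
      have hclose : Close M (G.tables M x n) c := ⟨hc, fun s hs a => by
        have h1 := hj (false, ⟨s, hs⟩, a)
        have h2 := hj (true, ⟨s, hs⟩, a)
        simp only [sgn, diff] at h1 h2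
        rw [abs_le]
        simp only [Bool.false_eq_true, if_false, if_true] at h1 h2
        constructor <;> linarith⟩
      have h1 := hclose.target_le G hx n false
      have h2 := hclose.target_le G hx n true
      simp only [Bool.not_false, Bool.not_true] at h1 h2
      have h3 : sgn p.1 * (G.target M (G.tables M x n) x n false -
          G.target M (G.tables M x n) x n true) ≤ M.γ * c := by
        refine (hsgn _ _).trans ?_
        rw [abs_le]
        constructor <;> linarith
      have h4 := mul_le_mul_of_nonneg_left h3
        (div_nonneg (G.appliedRate_nonneg M x n p.2.1 p.2.2) zero_le_two)
      rw [diff_succ]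
      linarith) hδ
  filter_upwards [key] with n hn
  refine ⟨hδ.le, fun s hs a => ?_⟩
  have h1 := hn (false, ⟨s, hs⟩, a)
  have h2 := hn (true, ⟨s, hs⟩, a)
  simp only [sgn, diff, Bool.false_eq_true, if_false, if_true, zero_div, zero_add] at h1 h2
  rw [abs_le]
  constructor <;> linarith

lemma avg_bounds {x : ℕ → Step S A} {n : ℕ} {D : ℝ} (h : Close M (G.tables M x n) D) {s : S}
    (hs : s ∉ M.terminal) (i : Bool) (a : A) :
    G.tables M x n i s a ≤ G.avg M x n s a + D / 2 ∧
      G.avg M x n s a - D / 2 ≤ G.tables M x n i s a := by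
  have := abs_le.1 (h.2 s hs a)
  rw [avg]
  cases i <;> constructor <;> linarith

lemma abs_avg_le (x : ℕ → Step S A) (n : ℕ) (s : S) (a : A) :
    |G.avg M x n s a| ≤ G.tableBound M := by
  have h3 := abs_le.1 (G.abs_tables_le M x n false s a)
  have h4 := abs_le.1 (G.abs_tables_le M x n true s a)
  rw [avg, abs_le]
  constructor <;> linarith

/-- The tables are asymptotically bounded by the largest feasible returns. -/
lemma eventually_avg_le [Nonempty A] {x : ℕ → Step S A} (hx : Regular M x)
    (hr : G.Exploring M x) (hclose : ∀ δ, 0 < δ → ∀ᶠ n in atTop, Close M (G.tables M x n) δ)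
    {δ : ℝ} (hδ : 0 < δ) :
    ∀ᶠ n in atTop, ∀ s, s ∉ M.terminal → ∀ a, G.avg M x n s a ≤ M.Qmax s a + δ := by
  set D := δ * (1 - M.γ) / 2 with hD
  have hγ := M.one_sub_γ_pos
  have hD0 : 0 < D := by positivity
  obtain ⟨N, hN⟩ := eventually_atTop.1 (hclose D hD0)
  -- The noise is zero because targets are bounded pathwise. The error `D` covers `γ * D / 2` inside
  -- the target and `D / 2` for replacing the updated table by the mean.
  have key := eventually_le_of_contraction (ι := {s // s ∉ M.terminal} × A)
    (u := fun n p => G.avg M x n p.1 p.2 - M.Qmax p.1 p.2)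
    (a := fun n p => G.appliedRate M x n p.1 p.2 / 2) (w := fun _ _ => 0)
    (γ := M.γ) (e := D) (B := G.tableBound M + ∑ s, ∑ a, |M.Qmax s a|)
    M.γ_nonneg M.γ_lt_one hD0.le
    (fun n p => by linarith [G.appliedRate_nonneg M x n p.1 p.2])
    (fun n p => by linarith [G.appliedRate_le_one M x n p.1 p.2])
    (fun p => not_summable_half (hr p.1 p.1.2 p.2))
    (fun p => ⟨0, by simp⟩)
    (fun n p => by
      have h1 := (abs_le.1 (G.abs_avg_le (M := M) x n p.1 p.2)).2
      have h2 : |M.Qmax p.1 p.2| ≤ ∑ s, ∑ a, |M.Qmax s a| :=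
        (Finset.single_le_sum (f := fun a => |M.Qmax p.1 a|) (fun _ _ => abs_nonneg _)
          (Finset.mem_univ p.2)).trans
        (Finset.single_le_sum (f := fun s => ∑ a, |M.Qmax s a|)
          (fun _ _ => Finset.sum_nonneg fun _ _ => abs_nonneg _) (Finset.mem_univ p.1.1))
      linarith [neg_abs_le (M.Qmax p.1 p.2)])
    N (fun n hn c hc hj p => by
      have hcl := hN n hn
      have h1 : G.appliedRate M x n p.1 p.2 *
          (G.target M (G.tables M x n) x n (x n).coin - G.tables M x n (x n).coin p.1 p.2) ≤
          G.appliedRate M x n p.1 p.2 *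
            (M.γ * c + D - (G.avg M x n p.1 p.2 - M.Qmax p.1 p.2)) := by
        refine G.appliedRate_mul_le M fun hs ha => ?_
        have h2 := G.target_le_Qmax hx (c := c + D / 2) (T := G.tables M x n) (by linarith)
          (fun s hs i b => by
            have := (G.avg_bounds hcl hs i b).1
            have := hj (⟨s, hs⟩, b)
            simp only at this
            linarith) n (x n).coin
        rw [← hs, ← ha] at h2
        have h3 := (G.avg_bounds hcl p.1.2 (x n).coin p.2).2
        nlinarith [M.γ_lt_one]
      rw [avg_succ]
      nlinarith) (half_pos hδ)
  filter_upwards [key] with n hn s hs a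
  have h1 := hn (⟨s, hs⟩, a)
  have h2 : D / (1 - M.γ) = δ / 2 := by
    rw [hD]
    field_simp
  simp only [h2] at h1
  linarith

variable (M)

/-- The value of a state under the table `f`. -/
def stateValue (f : S → A → ℝ) (s : S) : ℝ := if s ∈ M.terminal then 0 else ⨆ b, f s b

/-- The learning rate of the `n`-th step at the entry `(s, a)`. -/
def stepRate (x : ℕ → Step S A) (n : ℕ) (s : S) (a : A) : ℝ :=
  if s = (x n).state ∧ a = (x n).action then G.rateAlong x n else 0

/-- Ordinary one-step Q-learning with reward reduced by `e`, started at step `N` from the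
lower bound of all tables. -/
def lowerIter (N : ℕ) (e : ℝ) (x : ℕ → Step S A) : ℕ → S → A → ℝ
  | 0 => fun _ _ => -G.tableBound M
  | n + 1 => fun s a => lowerIter N e x n s a +
      (if N ≤ n then G.stepRate x n s a / 2 else 0) *
        (M.r s a - e + M.γ * stateValue M (lowerIter N e x n) (x n).next -
          lowerIter N e x n s a)

lemma lowerIter_succ (N : ℕ) (e : ℝ) (x : ℕ → Step S A) (n : ℕ) (s : S) (a : A) :
    G.lowerIter M N e x (n + 1) s a = G.lowerIter M N e x n s a +
      (if N ≤ n then G.stepRate x n s a / 2 else 0) *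
        (M.r s a - e + M.γ * stateValue M (G.lowerIter M N e x n) (x n).next -
          G.lowerIter M N e x n s a) := rfl

/-- The noise of `lowerIter` due to the random transition. -/
def transitionNoise (N : ℕ) (e : ℝ) (x : ℕ → Step S A) (n : ℕ) (s : S) (a : A) : ℝ :=
  G.stepRate x n s a / 2 * (M.γ * (stateValue M (G.lowerIter M N e x n) (x n).next -
    ∑ u, M.P s a u * stateValue M (G.lowerIter M N e x n) u))

lemma stepRate_nonneg (x : ℕ → Step S A) (n : ℕ) (s : S) (a : A) : 0 ≤ G.stepRate x n s a := by
  rw [stepRate]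
  split_ifs
  exacts [G.rateAlong_nonneg x n, le_rfl]

lemma stepRate_le_one (x : ℕ → Step S A) (n : ℕ) (s : S) (a : A) : G.stepRate x n s a ≤ 1 := by
  rw [stepRate]
  split_ifs
  exacts [G.rateAlong_le_one x n, zero_le_one]

lemma stepRate_eq_appliedRate {x : ℕ → Step S A} {n : ℕ} (h : Completed M x n) (s : S) (a : A) :
    G.stepRate x n s a = G.appliedRate M x n s a := by
  simp [stepRate, appliedRate, h]

lemma abs_stateValue_le [Nonempty A] {f : S → A → ℝ} {C : ℝ} (hC : 0 ≤ C)
    (hf : ∀ s a, |f s a| ≤ C) (s : S) : |stateValue M f s| ≤ C := by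
  rw [stateValue]
  split_ifs
  · simpa
  · obtain ⟨b, hb⟩ := exists_eq_ciSup_of_finite (f := f s)
    rw [← hb]
    exact hf s b

lemma abs_lowerIter_le [Nonempty A] (N : ℕ) {e : ℝ} (he0 : 0 ≤ e) (he1 : e ≤ 1)
    (x : ℕ → Step S A) (n : ℕ) (s : S) (a : A) :
    |G.lowerIter M N e x n s a| ≤ G.tableBound M := by
  have hC := G.tableBound_nonneg M
  induction n generalizing s a with
  | zero => simp [lowerIter, abs_of_nonneg hC]
  | succ n ih =>
    refine abs_add_mul_sub_le ?_ ?_ (ih s a) ?_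
    · split_ifs
      exacts [by linarith [G.stepRate_nonneg x n s a], le_rfl]
    · split_ifs
      exacts [by linarith [G.stepRate_le_one x n s a], zero_le_one]
    · have h1 := abs_le.1 (abs_stateValue_le M hC ih (x n).next)
      have h2 := abs_le.1 (M.abs_r_le s a)
      have h3 := G.rBound_add_le_tableBound M
      rw [abs_le]
      constructor <;> nlinarith [M.γ_nonneg]

lemma lowerIter_of_le (N : ℕ) (e : ℝ) (x : ℕ → Step S A) {n : ℕ} (hn : n ≤ N) (s : S) (a : A) :
    G.lowerIter M N e x n s a = -G.tableBound M := by
  induction n with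
  | zero => rfl
  | succ n ih =>
    rw [lowerIter_succ, if_neg (by omega), zero_mul, add_zero]
    exact ih (by omega)

variable {M}

/-- Comparison by monotonicity of the update. The reduction `4 * D` covers `γ * D` from
`Close.le_target`, `2 * γ * D` from `Close.le_boot`, and `D / 2` between the mean and the updated
table. -/
lemma lowerIter_le_avg [Nonempty A] {x : ℕ → Step S A} (hx : Regular M x) {N : ℕ} {D : ℝ}
    (hN : ∀ n, N ≤ n → Close M (G.tables M x n) D) {n : ℕ} (hn : N ≤ n) :
    ∀ s, s ∉ M.terminal → ∀ a, G.lowerIter M N (4 * D) x n s a ≤ G.avg M x n s a := by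
  induction n, hn using Nat.le_induction with
  | base =>
    intro s _ a
    rw [lowerIter_of_le _ _ _ _ _ le_rfl]
    exact (abs_le.1 (G.abs_avg_le x N s a)).1
  | succ n hn ih =>
    intro s hs a
    have hcl := hN n hn
    have hD := hcl.1
    rw [avg_succ, lowerIter_succ, if_pos hn, stepRate_eq_appliedRate _ _ (hx.completed n)]
    have h1 : G.appliedRate M x n s a *
        (M.r s a - 4 * D + M.γ * stateValue M (G.lowerIter M N (4 * D) x n) (x n).next -
          G.avg M x n s a) ≤ G.appliedRate M x n s a *
        (G.target M (G.tables M x n) x n (x n).coin - G.tables M x n (x n).coin s a) := by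
      refine G.appliedRate_mul_le M fun hs' ha' => ?_
      have h2 := hcl.le_target G hx n (x n).coin
      rw [← hs', ← ha'] at h2
      have h3 := (G.avg_bounds hcl hs (x n).coin a).1
      have h4 : stateValue M (G.lowerIter M N (4 * D) x n) (x n).next ≤
          (if (x n).next ∈ M.terminal then 0 else G.tables M x n (x n).coin (x n).next
            (G.boot n (G.tables M x n) (x n).coin (x n).next)) + 2 * D := by
        rw [stateValue]
        split_ifs with hterm
        · linarith
        · refine ciSup_le fun b => (ih _ hterm b).trans ?_
          have h5 := hcl.le_boot G hterm n (x n).coin false b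
          have h6 := hcl.le_boot G hterm n (x n).coin true b
          rw [avg]
          linarith
      have h5 := mul_le_mul_of_nonneg_left h4 M.γ_nonneg
      nlinarith [M.γ_lt_one]
    have h2 := ih s hs a
    have h3 := G.appliedRate_le_one M x n s a
    nlinarith

/-- One-step Q-learning with reduced reward approaches the accordingly reduced optimum. -/
lemma eventually_le_lowerIter [Nonempty A] {x : ℕ → Step S A} (hx : Regular M x)
    (hr : G.Exploring M x) {N : ℕ} {e : ℝ} (he0 : 0 ≤ e) (he1 : e ≤ 1)
    (hnoise : ∀ s, s ∉ M.terminal → ∀ a, ∃ l,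
      Tendsto (fun n => ∑ k ∈ Finset.range n, G.transitionNoise M N e x k s a) atTop (nhds l))
    {δ : ℝ} (hδ : 0 < δ) : ∀ᶠ n in atTop, ∀ s, s ∉ M.terminal → ∀ a,
      M.Qstar s a ≤ G.lowerIter M N e x n s a + e / (1 - M.γ) + δ := by
  have key := eventually_le_of_contraction (ι := {s // s ∉ M.terminal} × A)
    (u := fun n p => M.Qstar p.1 p.2 - G.lowerIter M N e x n p.1 p.2)
    (a := fun n p => G.appliedRate M x n p.1 p.2 / 2)
    (w := fun n p => -G.transitionNoise M N e x n p.1 p.2)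
    (γ := M.γ) (e := e) (B := G.tableBound M + ∑ s, ∑ a, |M.Qstar s a|)
    M.γ_nonneg M.γ_lt_one he0
    (fun n p => by linarith [G.appliedRate_nonneg M x n p.1 p.2])
    (fun n p => by linarith [G.appliedRate_le_one M x n p.1 p.2])
    (fun p => not_summable_half (hr p.1 p.1.2 p.2))
    (fun p => by
      obtain ⟨l, hl⟩ := hnoise p.1 p.1.2 p.2
      refine ⟨-l, ?_⟩
      simpa only [Finset.sum_neg_distrib] using hl.neg)
    (fun n p => by
      have h1 := (abs_le.1 (G.abs_lowerIter_le M N he0 he1 x n p.1 p.2)).1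
      have h2 : |M.Qstar p.1 p.2| ≤ ∑ s, ∑ a, |M.Qstar s a| :=
        (Finset.single_le_sum (f := fun a => |M.Qstar p.1 a|) (fun _ _ => abs_nonneg _)
          (Finset.mem_univ p.2)).trans
        (Finset.single_le_sum (f := fun s => ∑ a, |M.Qstar s a|)
          (fun _ _ => Finset.sum_nonneg fun _ _ => abs_nonneg _) (Finset.mem_univ p.1.1))
      linarith [le_abs_self (M.Qstar p.1 p.2)])
    N (fun n hn c hc hj p => by
      have h1 : ∑ u, M.P p.1 p.2 u * M.Vstar u ≤
          ∑ u, M.P p.1 p.2 u * stateValue M (G.lowerIter M N e x n) u + c := by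
        rw [← M.P_sum_add_const]
        refine M.P_sum_mono _ _ fun u _ => ?_
        rw [stateValue]
        split_ifs with hu
        · rw [M.Vstar_terminal hu]
          linarith
        · obtain ⟨b, hb⟩ := M.exists_Qstar_eq_Vstar u
          have h2 := hj (⟨u, hu⟩, b)
          have h3 := le_iSup_fin (G.lowerIter M N e x n u) b
          simp only at h2
          linarith
      have h2 := mul_le_mul_of_nonneg_left h1 M.γ_nonneg
      have h3 := M.Qstar_eq p.1 p.2
      have h4 := G.appliedRate_nonneg M x n p.1 p.2
      rw [lowerIter_succ, if_pos hn, transitionNoise, stepRate_eq_appliedRate _ _ (hx.completed n)]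
      nlinarith) hδ
  filter_upwards [key] with n hn s hs a
  have := hn (⟨s, hs⟩, a)
  simp only at this
  linarith

/-- On a regular path with convergent noise, the tables end up between the optimal action values
and the largest feasible returns. -/
lemma eventually_tables_mem [Nonempty A] {x : ℕ → Step S A} (hx : Regular M x)
    (hr : G.Exploring M x)
    (hcoin : ∀ s, s ∉ M.terminal → ∀ a, ∃ l,
      Tendsto (fun n => ∑ k ∈ Finset.range n, G.coinNoise M x k s a) atTop (nhds l))
    (htrans : ∀ N m : ℕ, ∀ s, s ∉ M.terminal → ∀ a, ∃ l, Tendsto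
      (fun n => ∑ k ∈ Finset.range n, G.transitionNoise M N (1 / (m + 1 : ℝ)) x k s a)
      atTop (nhds l))
    {δ : ℝ} (hδ : 0 < δ) : ∀ᶠ n in atTop, ∀ i s, s ∉ M.terminal → ∀ a,
      M.Qstar s a - δ ≤ G.tables M x n i s a ∧ G.tables M x n i s a ≤ M.Qmax s a + δ := by
  have hγ := M.one_sub_γ_pos
  have hclose := fun δ hδ => G.eventually_close hx hr hcoin (δ := δ) hδ
  -- The exceptional null set of the transition noise depends on `N` and on the reduction, so the
  -- reduction is taken from a countable family.
  obtain ⟨m, hm⟩ := exists_nat_one_div_lt (show 0 < δ * (1 - M.γ) / 3 by positivity)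
  set e : ℝ := 1 / (m + 1 : ℝ) with he
  have he0 : 0 < e := Nat.one_div_pos_of_nat
  have he1 : e ≤ 1 := by
    rw [he, div_le_one (by positivity)]
    linarith [(Nat.cast_nonneg m : (0 : ℝ) ≤ m)]
  obtain ⟨N, hN⟩ := eventually_atTop.1 (hclose (e / 4) (by positivity))
  have hlow := G.eventually_le_lowerIter hx hr (N := N) he0.le he1 (htrans N m)
    (δ := δ / 3) (by positivity)
  have hediv : e / (1 - M.γ) ≤ δ / 3 := by
    rw [div_le_iff₀ hγ]
    linarith
  filter_upwards [hlow, G.eventually_avg_le hx hr hclose (half_pos hδ),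
    hclose (δ / 2) (half_pos hδ),
    eventually_ge_atTop N] with n h1 h2 h3 hn i s hs a
  have h4 := G.lowerIter_le_avg hx hN hn s hs a
  rw [mul_div_cancel₀ e four_ne_zero] at h4
  have h5 := G.avg_bounds h3 hs i a
  have h6 := h1 s hs a
  have h7 := h2 s hs a
  constructor <;> linarith

end Algorithm

end

end GEM

/-! ### What the tables and the law of a run depend on. -/

namespace GEM

noncomputable section

open scoped Classical

/-- A step without its coin. -/
def Step.strip {S A : Type*} (y : Step S A) : Step S A := { y with coin := false }

/-- A step with its coin turned over. -/
def Step.flip {S A : Type*} (y : Step S A) : Step S A := { y with coin := !y.coin }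

namespace Algorithm

section Coins

variable {S A : Type*}

lemma strip_eq_iff {u v : Step S A} :
    u.strip = v.strip ↔ u.state = v.state ∧ u.action = v.action ∧ u.next = v.next := by
  simp [Step.strip]

/-- The path `x` with the coin of step `n` turned over. -/
def flipAt (n : ℕ) (x : ℕ → Step S A) : ℕ → Step S A := Function.update x n (x n).flip

lemma flipAt_strip (n : ℕ) (x : ℕ → Step S A) (m : ℕ) :
    (flipAt n x m).strip = (x m).strip := by
  rw [flipAt, Function.update_apply]
  split_ifs with h
  · rw [h]
    rfl
  · rfl

lemma flipAt_of_ne {n m : ℕ} (h : m ≠ n) (x : ℕ → Step S A) : flipAt n x m = x m :=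
  Function.update_of_ne h _ _

end Coins

variable {S A : Type*} [Fintype S] [Fintype A] (M : EpisodicMDP S A) (G : Algorithm S A)

/-- From step `k` to the end of the episode of `x`, the two paths agree up to the coins. -/
def SameEpisode (x y : ℕ → Step S A) (k : ℕ) : Prop :=
  ∀ l, k ≤ l → (∀ i, k ≤ i → i < l → (x i).next ∉ M.terminal) → (x l).strip = (y l).strip

variable {M} {x y : ℕ → Step S A}

lemma SameEpisode.head {k : ℕ} (h : SameEpisode M x y k) : (x k).strip = (y k).strip :=
  h k le_rfl fun _ h1 h2 => absurd h1 (not_le.2 h2)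

lemma SameEpisode.tail {k : ℕ} (h : SameEpisode M x y k) (hk : (x k).next ∉ M.terminal) :
    SameEpisode M x y (k + 1) := fun l hl hi => h l (by omega) fun i h1 h2 => by
  rcases h1.eq_or_lt with rfl | h1
  · exact hk
  · exact hi i h1 h2

lemma SameEpisode.rollout_eq (T : Tables S A) (β : Bool → S → A) (j : Bool) (h : ℕ) {t : ℕ}
    (hs : SameEpisode M x y t) : rollout M T β x j h t = rollout M T β y j h t := by
  induction h generalizing t with
  | zero => simp only [rollout, (strip_eq_iff.1 hs.head).1]
  | succ h ih =>
    obtain ⟨h1, h2, h3⟩ := strip_eq_iff.1 hs.head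
    simp only [rollout]
    rw [← h1, ← h2, ← h3]
    split_ifs with hterm
    · rfl
    · rw [ih (hs.tail hterm)]

lemma SameEpisode.target_eq (T : Tables S A) (i : Bool) {n : ℕ} (hs : SameEpisode M x y n) :
    G.target M T x n i = G.target M T y n i := by
  simp only [target, hs.rollout_eq]

lemma rateAlong_congr {n : ℕ} (h : ∀ m, m < n → x m = y m) (hs : (x n).strip = (y n).strip) :
    G.rateAlong x n = G.rateAlong y n := by
  obtain ⟨h1, h2, -⟩ := strip_eq_iff.1 hs
  simp only [rateAlong, h1, h2]
  congr 1
  ext m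
  exact h m m.2

lemma tables_congr {n : ℕ} (h : ∀ m, m < n → x m = y m)
    (hc : ∀ m, m < n → (Completed M x m ↔ Completed M y m) ∧
      (Completed M x m → SameEpisode M x y m)) : G.tables M x n = G.tables M y n := by
  induction n with
  | zero => rfl
  | succ n ih =>
    have ih' := ih (fun m hm => h m (by omega)) fun m hm => hc m (by omega)
    obtain ⟨h1, h2⟩ := hc n (by omega)
    have h3 := h n (by omega)
    ext i s a
    by_cases hx : Completed M x n
    · have h4 := rateAlong_congr G (fun m hm => h m (by omega)) (congrArg Step.strip h3)
      have h5 := fun T => (h2 hx).target_eq G T i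
      simp only [tables, h1, h3, ih', h4, h5]
    · have hy : ¬ Completed M y n := fun hy => hx (h1.2 hy)
      simp only [tables, hx, hy, false_and, if_false, ih']

/-- At an episode boundary all earlier episodes have ended before `m`, so no later step has entered
the tables. -/
lemma tables_congr_of_start {m : ℕ}
    (hm : ∀ j, j < m → ∃ e, j ≤ e ∧ e < m ∧ (x e).next ∈ M.terminal)
    (h : ∀ j, j < m → x j = y j) : G.tables M x m = G.tables M y m := by
  refine G.tables_congr h fun j hj => ?_
  obtain ⟨e, h1, h2, h3⟩ := hm j hj
  refine ⟨⟨fun _ => ⟨e, h1, by rwa [← h e h2]⟩, fun _ => ⟨e, h1, h3⟩⟩, fun _ l hl hi => ?_⟩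
  have : l ≤ e := by
    by_contra! hel
    exact hi e h1 hel h3
  rw [h l (by omega)]

lemma episodeStart_spec (x : ℕ → Step S A) (k : ℕ) : ∀ j, j < episodeStart M x k →
    ∃ e, j ≤ e ∧ e < episodeStart M x k ∧ (x e).next ∈ M.terminal := by
  induction k with
  | zero => simp [episodeStart]
  | succ k ih =>
    intro j hj
    rw [episodeStart] at hj ⊢
    split_ifs at hj ⊢ with h
    · exact ⟨k, by omega, by omega, h⟩
    · exact ih j hj

lemma episodeStart_le (x : ℕ → Step S A) (k : ℕ) : episodeStart M x k ≤ k := by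
  induction k with
  | zero => simp [episodeStart]
  | succ k ih =>
    rw [episodeStart]
    split_ifs <;> omega

lemma episodeStart_le_of_forall {n k : ℕ} (hnk : n ≤ k)
    (h : ∀ i, n ≤ i → i < k → (x i).next ∉ M.terminal) : episodeStart M x k ≤ n := by
  induction k, hnk using Nat.le_induction with
  | base => exact episodeStart_le x n
  | succ k hk ih =>
    rw [episodeStart, if_neg (h k hk (by omega))]
    exact ih fun i h1 h2 => h i h1 (by omega)

lemma episodeStart_congr {k : ℕ} (h : ∀ j, j < k → (x j).next = (y j).next) :
    episodeStart M x k = episodeStart M y k := by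
  induction k with
  | zero => rfl
  | succ k ih =>
    rw [episodeStart, episodeStart, h k (by omega), ih fun j hj => h j (by omega)]

lemma stateProb_congr {k : ℕ} (h : ∀ j, j < k → (x j).next = (y j).next) :
    G.stateProb M x k = G.stateProb M y k := by
  ext s
  cases k with
  | zero => rfl
  | succ k => rw [stateProb, stateProb, h k (by omega)]

lemma behaviour_congr {k : ℕ} (hn : ∀ j, j < k → (x j).next = (y j).next)
    (h : ∀ j, j < episodeStart M x k → x j = y j) :
    G.behaviour M x k = G.behaviour M y k := by
  ext s a
  rw [behaviour, behaviour, ← episodeStart_congr hn,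
    G.tables_congr_of_start (episodeStart_spec x k) h]

variable (M)

/-- The two paths agree on the steps before `n`, and up to the coins also on the rest of the
episode of step `n` if that episode ends. -/
structure Agree (n : ℕ) (x y : ℕ → Step S A) : Prop where
  prefix_eq : ∀ m, m < n → x m = y m
  completed_iff : Completed M x n ↔ Completed M y n
  same : Completed M x n → SameEpisode M x y n

variable {M}

lemma completed_of_next {n : ℕ} (h : (x n).next ∈ M.terminal) : Completed M x n :=
  ⟨n, le_rfl, h⟩

lemma completed_succ_iff {n : ℕ} (h : (x n).next ∉ M.terminal) :
    Completed M x (n + 1) ↔ Completed M x n := by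
  constructor
  · rintro ⟨e, h1, h2⟩
    exact ⟨e, by omega, h2⟩
  · rintro ⟨e, h1, h2⟩
    refine ⟨e, Nat.lt_of_le_of_ne h1 ?_, h2⟩
    rintro rfl
    exact h h2

/-- Monotonicity of the filtration for the coins. If step `n` ends its episode, there is no
remainder to know; otherwise the remainder belongs to the episode of step `n + 1`. -/
lemma Agree.pred {n : ℕ} (h : Agree M (n + 1) x y) : Agree M n x y := by
  have hn := h.prefix_eq n (by omega)
  by_cases ht : (x n).next ∈ M.terminal
  · refine ⟨fun m hm => h.prefix_eq m (by omega),
      ⟨fun _ => completed_of_next (hn ▸ ht), fun _ => completed_of_next ht⟩, fun _ l hl hi => ?_⟩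
    rcases hl.eq_or_lt with rfl | hl
    · rw [hn]
    · exact absurd ht (hi n le_rfl hl)
  · refine ⟨fun m hm => h.prefix_eq m (by omega), ?_, fun hc l hl hi => ?_⟩
    · rw [← completed_succ_iff ht, ← completed_succ_iff (hn ▸ ht : (y n).next ∉ M.terminal)]
      exact h.completed_iff
    · rcases hl.eq_or_lt with rfl | hl
      · rw [hn]
      · exact h.same ((completed_succ_iff ht).2 hc) l hl fun i h1 h2 => hi i (by omega) h2

lemma Agree.of_le {n m : ℕ} (hmn : m ≤ n) (h : Agree M n x y) : Agree M m x y := by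
  induction n, hmn using Nat.le_induction with
  | base => exact h
  | succ n _ ih => exact ih h.pred

lemma Agree.tables_eq {n : ℕ} (h : Agree M n x y) : G.tables M x n = G.tables M y n :=
  G.tables_congr h.prefix_eq fun _ hm =>
    ⟨(h.of_le hm.le).completed_iff, (h.of_le hm.le).same⟩

lemma Agree.appliedRate_eq {n : ℕ} (h : Agree M n x y) (s : S) (a : A) :
    G.appliedRate M x n s a = G.appliedRate M y n s a := by
  by_cases hc : Completed M x n
  · have hs := (h.same hc).head
    obtain ⟨h1, h2, -⟩ := strip_eq_iff.1 hs
    simp only [appliedRate, h.completed_iff, h1, h2, rateAlong_congr G h.prefix_eq hs]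
  · simp only [appliedRate, hc, h.completed_iff.not.1 hc, false_and, if_false]

/-- In an episode that never ends, the target may depend on unobserved steps, but then the applied
rate is zero. -/
lemma Agree.rate_mul_surprise_eq {n : ℕ} (h : Agree M n x y) (s : S) (a : A) :
    G.appliedRate M x n s a / 2 * G.surprise M x n s a =
      G.appliedRate M y n s a / 2 * G.surprise M y n s a := by
  by_cases hc : Completed M x n
  · simp only [surprise, h.appliedRate_eq G, h.tables_eq G, (h.same hc).target_eq G]
  · have h1 : G.appliedRate M x n s a = 0 := by simp [appliedRate, hc]
    rw [← h.appliedRate_eq G, h1, zero_div, zero_mul, zero_mul]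

lemma Agree.coinNoise_eq {n : ℕ} (h : Agree M (n + 1) x y) (s : S) (a : A) :
    G.coinNoise M x n s a = G.coinNoise M y n s a := by
  rw [coinNoise, coinNoise, h.prefix_eq n (by omega), h.pred.rate_mul_surprise_eq G]

variable (M)

/-- The end of the episode of step `n`, or `n` if that episode does not end. -/
def horizon (x : ℕ → Step S A) (n : ℕ) : ℕ :=
  if h : Completed M x n then Nat.find h + 1 else n

/-- The steps before `n` and the rest of the episode of step `n` without coins. -/
def code (n : ℕ) (x : ℕ → Step S A) : List (Step S A) :=
  (List.range (horizon M x n)).map fun m => if m < n then x m else (x m).strip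

variable {M}

lemma horizon_eq_succ {n e : ℕ} (hne : n ≤ e) (he : (x e).next ∈ M.terminal)
    (hi : ∀ i, n ≤ i → i < e → (x i).next ∉ M.terminal) : horizon M x n = e + 1 := by
  have hc : Completed M x n := ⟨e, hne, he⟩
  rw [horizon, dif_pos hc, (Nat.find_eq_iff hc).2 ⟨⟨hne, he⟩, fun i h1 h2 => hi i h2.1 h1 h2.2⟩]

lemma horizon_of_not {n : ℕ} (h : ¬ Completed M x n) : horizon M x n = n := dif_neg h

lemma exists_first {n : ℕ} (h : Completed M x n) : ∃ e, n ≤ e ∧ (x e).next ∈ M.terminal ∧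
    ∀ i, n ≤ i → i < e → (x i).next ∉ M.terminal :=
  ⟨Nat.find h, (Nat.find_spec h).1, (Nat.find_spec h).2,
    fun _ h1 h2 h3 => Nat.find_min h h2 ⟨h1, h3⟩⟩

lemma completed_iff_lt_horizon {n : ℕ} : Completed M x n ↔ n < horizon M x n := by
  constructor
  · intro h
    obtain ⟨e, h1, h2, h3⟩ := exists_first h
    rw [horizon_eq_succ h1 h2 h3]
    omega
  · intro h
    by_contra hc
    rw [horizon_of_not hc] at h
    exact lt_irrefl _ h

/-- Lists give the agreement classes a countable type. The length of the list reveals where the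
episode ends, or that it does not. -/
lemma code_eq_iff {n : ℕ} : code M n x = code M n y ↔ Agree M n x y := by
  constructor
  · intro h
    have hlen : horizon M x n = horizon M y n := by simpa [code] using congrArg List.length h
    rw [code, code, ← hlen, List.map_inj_left] at h
    have hn : n ≤ horizon M x n := by
      by_cases hc : Completed M x n
      · exact (completed_iff_lt_horizon.1 hc).le
      · rw [horizon_of_not hc]
    refine ⟨fun m hm => ?_, ?_, fun hc l hl hi => ?_⟩
    · simpa [hm] using h m (List.mem_range.2 (by omega))
    · rw [completed_iff_lt_horizon, completed_iff_lt_horizon, hlen]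
    · obtain ⟨e, h1, h2, h3⟩ := exists_first hc
      have hle : l ≤ e := by
        by_contra! hel
        exact hi e h1 hel h2
      have := h l (List.mem_range.2 (by rw [horizon_eq_succ h1 h2 h3]; omega))
      simpa [not_lt.2 hl] using this
  · intro h
    by_cases hc : Completed M x n
    · obtain ⟨e, h1, h2, h3⟩ := exists_first hc
      have hs : ∀ l, n ≤ l → l ≤ e → (x l).strip = (y l).strip := fun l hl hle =>
        h.same hc l hl fun i hi hil => h3 i hi (by omega)
      have hy : horizon M y n = e + 1 := by
        refine horizon_eq_succ h1 ?_ fun i hi hie => ?_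
        · rw [← (strip_eq_iff.1 (hs e h1 le_rfl)).2.2]
          exact h2
        · rw [← (strip_eq_iff.1 (hs i hi hie.le)).2.2]
          exact h3 i hi hie
      rw [code, code, horizon_eq_succ h1 h2 h3, hy, List.map_inj_left]
      intro m hm
      rw [List.mem_range] at hm
      split_ifs with hmn
      · exact h.prefix_eq m hmn
      · exact hs m (by omega) (by omega)
    · rw [code, code, horizon_of_not hc, horizon_of_not (h.completed_iff.not.1 hc),
        List.map_inj_left]
      intro m hm
      rw [List.mem_range] at hm
      simpa [hm] using h.prefix_eq m hm

variable (M)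

/-- The conditional probability of step `k` of the path `x`, given the earlier steps. -/
def stepProb (x : ℕ → Step S A) (k : ℕ) : ℝ :=
  G.stateProb M x k (x k).state * G.behaviour M x k (x k).state (x k).action *
    M.P (x k).state (x k).action (x k).next * (1 / 2)

lemma stepProb_congr {k : ℕ} (h : ∀ j, j < k + 1 → x j = y j) :
    G.stepProb M x k = G.stepProb M y k := by
  have h' : ∀ j, j < k → x j = y j := fun j hj => h j (by omega)
  have hn : ∀ j, j < k → (x j).next = (y j).next := fun j hj => by rw [h' j hj]
  rw [stepProb, stepProb, h k (by omega), G.stateProb_congr hn,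
    G.behaviour_congr hn fun j hj => h' j (hj.trans_le (episodeStart_le x k))]

/-- Up to the end of the episode of step `n`, behaviour is set by the tables at an episode start no
later than `n`, where the coin of step `n` has not acted. -/
lemma stepProb_flipAt {n k : ℕ} (h : ∀ i, n ≤ i → i < k → (x i).next ∉ M.terminal) :
    G.stepProb M (flipAt n x) k = G.stepProb M x k := by
  obtain ⟨h1, h2, h3⟩ := strip_eq_iff.1 (flipAt_strip n x k)
  have hn : ∀ j, j < k → (x j).next = (flipAt n x j).next := fun j _ =>
    (strip_eq_iff.1 (flipAt_strip n x j)).2.2.symm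
  rw [stepProb, stepProb, h1, h2, h3, G.stateProb_congr hn, G.behaviour_congr hn fun j hj => ?_]
  refine (flipAt_of_ne ?_ x).symm
  rcases le_total n k with hnk | hnk
  · have := episodeStart_le_of_forall hnk h
    omega
  · have := episodeStart_le (M := M) x k
    omega

/-- Unlike the tables, this iteration sees only the steps before `n`: it looks one step ahead and
uses rates that ignore whether the episode ends. -/
lemma lowerIter_congr (N : ℕ) (e : ℝ) {n : ℕ} (h : ∀ j, j < n → x j = y j) :
    G.lowerIter M N e x n = G.lowerIter M N e y n := by
  induction n with
  | zero => rfl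
  | succ n ih =>
    have h1 := h n (by omega)
    have h2 := rateAlong_congr G (fun m hm => h m (by omega)) (congrArg Step.strip h1)
    ext s a
    simp only [lowerIter_succ, stepRate, ih fun j hj => h j (by omega), h1, h2]

lemma stepRate_congr {n : ℕ} (h : ∀ j, j < n + 1 → x j = y j) :
    G.stepRate x n = G.stepRate y n := by
  have h1 := h n (by omega)
  ext s a
  simp only [stepRate, h1, rateAlong_congr G (fun m hm => h m (by omega)) (congrArg Step.strip h1)]

lemma transitionNoise_congr (N : ℕ) (e : ℝ) {n : ℕ} (h : ∀ j, j < n + 1 → x j = y j) :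
    G.transitionNoise M N e x n = G.transitionNoise M N e y n := by
  have hL := G.lowerIter_congr M N e (x := x) (y := y) fun j (hj : j < n) => h j (by omega)
  ext s a
  simp only [transitionNoise, G.stepRate_congr h, h n (by omega), hL]

end Algorithm

end

end GEM

/-! ### Conditional means of the two noises and almost sure convergence. -/

namespace GEM

noncomputable section

open scoped Classical

/-- A step is given by its state, its action, its coin and its next state. -/
def stepEquiv (S A : Type*) : Step S A ≃ S × A × Bool × S where
  toFun y := (y.state, y.action, y.coin, y.next)
  invFun p := ⟨p.1, p.2.1, p.2.2.2, p.2.2.1⟩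
  left_inv _ := rfl
  right_inv _ := rfl

instance {S A : Type*} [Fintype S] [Fintype A] : Fintype (Step S A) :=
  Fintype.ofEquiv _ (stepEquiv S A).symm

lemma sum_step {S A : Type*} [Fintype S] [Fintype A] (f : Step S A → ℝ) :
    ∑ y, f y = ∑ s, ∑ a, ∑ c, ∑ u, f ⟨s, a, u, c⟩ := by
  rw [← (stepEquiv S A).symm.sum_comp]
  simp only [Fintype.sum_prod_type]
  rfl

lemma setIntegral_comp_fintype {Ω β : Type*} [MeasurableSpace Ω] {ℙ : Measure Ω}
    [IsFiniteMeasure ℙ] [Fintype β] {Y : Ω → β} (hY : ∀ y, MeasurableSet {ω | Y ω = y})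
    (E : Set Ω) (F : β → ℝ) :
    ∫ ω in E, F (Y ω) ∂ℙ = ∑ y, ℙ.real ({ω | Y ω = y} ∩ E) * F y := by
  have h : (fun ω => F (Y ω)) = fun ω => ∑ y, {ω | Y ω = y}.indicator (fun _ => F y) ω := by
    ext ω
    rw [Finset.sum_eq_single (Y ω)]
    · simp
    · intro y _ hy
      exact Set.indicator_of_notMem (fun h : Y ω = y => hy h.symm) _
    · simp
  rw [h, integral_finsetSum _ fun y _ => (integrable_const _).indicator (hY y)]
  refine Finset.sum_congr rfl fun y _ => ?_
  rw [integral_indicator_const _ (hY y), measureReal_restrict_apply (hY y), smul_eq_mul]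

lemma fiber_eq_empty {Ω β : Type*} {Z : Ω → β} {z : β} (h : ¬ ∃ ω, Z ω = z) :
    {ω | Z ω = z} = ∅ := by
  ext ω
  simp only [Set.mem_ofPred_eq, Set.mem_empty_iff_false, iff_false]
  exact fun hω => h ⟨ω, hω⟩

namespace Algorithm

section Paths

variable {S A : Type*}

/-- Extension of a finite path by a constant. -/
def extend [Nonempty S] [Nonempty A] {N : ℕ} (q : Fin N → Step S A) (m : ℕ) : Step S A :=
  if h : m < N then q ⟨m, h⟩ else
    ⟨Classical.arbitrary S, Classical.arbitrary A, Classical.arbitrary S, false⟩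

lemma extend_apply [Nonempty S] [Nonempty A] {N : ℕ} (q : Fin N → Step S A) (m : Fin N) :
    extend q m = q m := dif_pos m.2

/-- The path `y` agrees up to `e` with `x`, without coins from step `n` on. -/
def Masked (n e : ℕ) (x y : ℕ → Step S A) : Prop :=
  (∀ m, m < n → y m = x m) ∧ ∀ m, n ≤ m → m < e → (y m).strip = (x m).strip

lemma Masked.congr {n e : ℕ} (hne : n ≤ e) {x y z : ℕ → Step S A} (h : Masked n e x y)
    (hyz : ∀ m, m < e → y m = z m) : Masked n e x z :=
  ⟨fun m hm => (hyz m (by omega)).symm.trans (h.1 m hm),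
    fun m hn hm => (hyz m hm) ▸ h.2 m hn hm⟩

lemma flip_flip (u : Step S A) : u.flip.flip = u := by
  simp [Step.flip]

lemma flipAt_flipAt (n : ℕ) (x : ℕ → Step S A) : flipAt n (flipAt n x) = x := by
  simp [flipAt, flip_flip]

/-- The restriction of `flipAt` to finite paths. -/
def flipFin [Nonempty S] [Nonempty A] {N : ℕ} (n : ℕ) (q : Fin N → Step S A) : Fin N → Step S A :=
  fun m => flipAt n (extend q) m

lemma extend_flipFin [Nonempty S] [Nonempty A] {N n : ℕ} (hn : n < N) (q : Fin N → Step S A) :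
    extend (flipFin n q) = flipAt n (extend q) := by
  ext1 m
  by_cases hm : m < N
  · exact extend_apply (flipFin n q) ⟨m, hm⟩
  · rw [flipAt_of_ne (by omega)]
    simp [extend, hm]

lemma flipFin_flipFin [Nonempty S] [Nonempty A] {N n : ℕ} (hn : n < N) (q : Fin N → Step S A) :
    flipFin n (flipFin n q) = q := by
  ext1 m
  rw [flipFin, extend_flipFin hn, flipAt_flipAt, extend_apply]

lemma masked_flipAt {n e : ℕ} {x y : ℕ → Step S A} (h : Masked n e x y) :
    Masked n e x (flipAt n y) :=
  ⟨fun m hm => by rw [flipAt_of_ne hm.ne, h.1 m hm],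
    fun m hn hm => by rw [flipAt_strip, h.2 m hn hm]⟩

lemma flipAt_coin (n : ℕ) (x : ℕ → Step S A) : (flipAt n x n).coin = !(x n).coin := by
  simp [flipAt, Step.flip]

end Paths

variable {S A Ω : Type*} [Fintype S] [Fintype A] [MeasurableSpace Ω] {M : EpisodicMDP S A}
  {G : Algorithm S A} {ℙ : Measure Ω} {X : ℕ → Ω → Step S A}

namespace IsRun

lemma measurableSet_of_prefix (hX : G.IsRun M ℙ X) (N : ℕ) {p : (ℕ → Step S A) → Prop}
    (hp : ∀ x y, (∀ m, m < N → x m = y m) → p x → p y) :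
    MeasurableSet {ω | p fun m => X m ω} := by
  have h : {ω | p fun m => X m ω} =
      ⋃ q ∈ {q : Fin N → Step S A | ∃ x, p x ∧ ∀ m : Fin N, x m = q m},
        ⋂ m : Fin N, {ω | X m ω = q m} := by
    ext ω
    simp only [Set.mem_ofPred_eq, Set.mem_iUnion, Set.mem_iInter, exists_prop]
    constructor
    · intro h
      exact ⟨fun m => X m ω, ⟨_, h, fun _ => rfl⟩, fun _ => rfl⟩
    · rintro ⟨q, ⟨x, hx, hq⟩, hω⟩
      exact hp x _ (fun m hm => (hq ⟨m, hm⟩).trans (hω ⟨m, hm⟩).symm) hx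
  rw [h]
  exact MeasurableSet.biUnion (Set.to_countable _) fun q _ =>
    MeasurableSet.iInter fun m => hX.meas m (q m)

lemma measurableSet_completed (hX : G.IsRun M ℙ X) (n : ℕ) :
    MeasurableSet {ω | Completed M (fun m => X m ω) n} := by
  have : {ω | Completed M (fun m => X m ω) n} =
      ⋃ e, {ω | n ≤ e ∧ (X e ω).next ∈ M.terminal} := by
    ext ω
    simp [Completed]
  rw [this]
  exact MeasurableSet.iUnion fun e => hX.measurableSet_of_prefix (e + 1)
    (p := fun x => n ≤ e ∧ (x e).next ∈ M.terminal) fun x y hxy hx => by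
      rwa [← hxy e (by omega)]

variable [IsProbabilityMeasure ℙ]

lemma real_prefix (hX : G.IsRun M ℙ X) (x : ℕ → Step S A) (N : ℕ) :
    ℙ.real {ω | ∀ m, m < N → X m ω = x m} = ∏ k ∈ Finset.range N, G.stepProb M x k := by
  induction N with
  | zero => simp
  | succ N ih => rw [hX.law, ih, Finset.prod_range_succ, stepProb]

lemma real_of_prefix [Nonempty S] [Nonempty A] (hX : G.IsRun M ℙ X) (N : ℕ)
    {p : (ℕ → Step S A) → Prop} (hp : ∀ x y, (∀ m, m < N → x m = y m) → p x → p y) :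
    ℙ.real {ω | p fun m => X m ω} =
      ∑ q : Fin N → Step S A with p (extend q),
        ∏ k ∈ Finset.range N, G.stepProb M (extend q) k := by
  have h : {ω | p fun m => X m ω} =
      ⋃ q ∈ Finset.univ.filter (fun q : Fin N → Step S A => p (extend q)),
        {ω | ∀ m, m < N → X m ω = extend q m} := by
    ext ω
    simp only [Set.mem_ofPred_eq, Set.mem_iUnion, Finset.mem_filter, Finset.mem_univ, true_and,
      exists_prop]
    constructor
    · intro h
      have he : ∀ m, m < N → X m ω = extend (fun m : Fin N => X m ω) m := fun m hm =>
        (extend_apply (fun m : Fin N => X m ω) ⟨m, hm⟩).symm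
      exact ⟨fun m => X m ω, hp _ _ he h, he⟩
    · rintro ⟨q, hq, hω⟩
      exact hp _ _ (fun m hm => (hω m hm).symm) hq
  rw [h, measureReal_biUnion_finset]
  · exact Finset.sum_congr rfl fun q _ => hX.real_prefix _ N
  · intro q _ q' _ hne
    refine Set.disjoint_left.2 fun ω h1 h2 => hne ?_
    ext1 m
    rw [← extend_apply q, ← extend_apply q']
    exact (h1 m m.2).symm.trans (h2 m m.2)
  · intro q _
    exact hX.measurableSet_of_prefix N (p := fun x => ∀ m, m < N → x m = extend q m)
      fun x y hxy hx m hm => (hxy m hm).symm.trans (hx m hm)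

/-- The exceptional event is, for each `n`, a finite union of cylinders whose probability contains a
zero factor. -/
lemma ae_stepProb_ne_zero [Nonempty S] [Nonempty A] (hX : G.IsRun M ℙ X) :
    ∀ᵐ ω ∂ℙ, ∀ n, G.stepProb M (fun m => X m ω) n ≠ 0 := by
  refine ae_all_iff.2 fun n => ?_
  have h := hX.real_of_prefix (n + 1) (p := fun x => G.stepProb M x n = 0)
    fun x y hxy hx => (G.stepProb_congr M hxy).symm.trans hx
  rw [Finset.sum_eq_zero fun q hq => by
    rw [Finset.prod_range_succ, (Finset.mem_filter.1 hq).2, mul_zero],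
    measureReal_eq_zero_iff] at h
  rw [ae_iff]
  simpa using h

lemma ae_feasible [Nonempty S] [Nonempty A] (hX : G.IsRun M ℙ X) :
    ∀ᵐ ω ∂ℙ, (∀ n, 0 < M.P (X n ω).state (X n ω).action (X n ω).next) ∧
      ∀ n, (X n ω).next ∉ M.terminal → (X (n + 1) ω).state = (X n ω).next := by
  filter_upwards [hX.ae_stepProb_ne_zero] with ω hω
  constructor
  · intro n
    refine (M.P_nonneg _ _ _).lt_of_ne fun h => hω n ?_
    rw [stepProb, ← h, mul_zero, zero_mul]
  · intro n hn
    by_contra hne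
    refine hω (n + 1) ?_
    rw [stepProb, stateProb, if_neg hn, if_neg hne]
    ring

end IsRun

section Fibers

variable {x y : ℕ → Step S A} {n : ℕ}

lemma agree_iff_masked {e : ℕ} (hne : n ≤ e) (he : (x e).next ∈ M.terminal)
    (hi : ∀ i, n ≤ i → i < e → (x i).next ∉ M.terminal) :
    Agree M n x y ↔ Masked n (e + 1) x y := by
  constructor
  · intro h
    exact ⟨fun m hm => (h.prefix_eq m hm).symm, fun m hm hme =>
      (h.same ⟨e, hne, he⟩ m hm fun i h1 h2 => hi i h1 (by omega)).symm⟩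
  · intro h
    refine ⟨fun m hm => (h.1 m hm).symm, ⟨fun _ => ⟨e, hne, ?_⟩, fun _ => ⟨e, hne, he⟩⟩,
      fun _ l hl hil => ?_⟩
    · rwa [(strip_eq_iff.1 (h.2 e hne (by omega))).2.2]
    · have : l ≤ e := by
        by_contra! hel
        exact hil e hne hel he
      exact (h.2 l hl (by omega)).symm

lemma agree_iff_of_not_completed (hc : ¬ Completed M x n) :
    Agree M n x y ↔ (∀ m, m < n → y m = x m) ∧ ¬ Completed M y n :=
  ⟨fun h => ⟨fun m hm => (h.prefix_eq m hm).symm, h.completed_iff.not.1 hc⟩,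
    fun h => ⟨fun m hm => (h.1 m hm).symm, iff_of_false hc h.2, fun h' => absurd h' hc⟩⟩

lemma fiber_code_eq {Ω : Type*} {X : ℕ → Ω → Step S A} (n : ℕ) (ω₀ : Ω) :
    {ω | code M n (fun m => X m ω) = code M n (fun m => X m ω₀)} =
      {ω | Agree M n (fun m => X m ω₀) fun m => X m ω} := by
  ext ω
  rw [Set.mem_ofPred_eq, eq_comm, code_eq_iff]
  rfl

end Fibers

namespace IsRun

lemma measurableSet_agree (hX : G.IsRun M ℙ X) (n : ℕ) (x : ℕ → Step S A) :
    MeasurableSet {ω | Agree M n x fun m => X m ω} := by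
  by_cases hc : Completed M x n
  · obtain ⟨e, h1, h2, h3⟩ := exists_first hc
    simp only [agree_iff_masked h1 h2 h3]
    exact hX.measurableSet_of_prefix (e + 1) (p := Masked n (e + 1) x)
      fun y z hyz hy => hy.congr (by omega) hyz
  · simp only [agree_iff_of_not_completed hc]
    exact (hX.measurableSet_of_prefix n (p := fun y => ∀ m, m < n → y m = x m)
      fun y z hyz hy m hm => (hyz m hm).symm.trans (hy m hm)).inter
      (hX.measurableSet_completed n).compl

lemma measurableSet_code (hX : G.IsRun M ℙ X) (n : ℕ) (z : List (Step S A)) :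
    MeasurableSet {ω | code M n (fun m => X m ω) = z} := by
  by_cases hz : ∃ ω₀, code M n (fun m => X m ω₀) = z
  · obtain ⟨ω₀, rfl⟩ := hz
    rw [fiber_code_eq]
    exact hX.measurableSet_agree n _
  · rw [fiber_eq_empty hz]
    exact MeasurableSet.empty

lemma measurableSet_coin (hX : G.IsRun M ℙ X) (n : ℕ) (c : Bool) :
    MeasurableSet {ω | (X n ω).coin = c} :=
  hX.measurableSet_of_prefix (n + 1) (p := fun x => (x n).coin = c) fun x y hxy hx => by
    rw [← hxy n (by omega), hx]

lemma measurableSet_fin_prefix (hX : G.IsRun M ℙ X) (n : ℕ) (z : Fin n → Step S A) :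
    MeasurableSet {ω | (fun m : Fin n => X m ω) = z} :=
  hX.measurableSet_of_prefix n (p := fun x => (fun m : Fin n => x m) = z) fun x y hxy hx => by
    rw [← hx]
    ext1 m
    exact (hxy m m.2).symm

/-- With the past fixed, the integral is a finite sum over the possible steps `n`; for given state,
action and coin, the sum over next states is a centred average under `P`. -/
lemma setIntegral_transitionNoise [IsProbabilityMeasure ℙ] (hX : G.IsRun M ℙ X) (N : ℕ)
    (e : ℝ) (n : ℕ) (s : S) (a : A) (z : Fin n → Step S A) :
    ∫ ω in {ω | (fun m : Fin n => X m ω) = z},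
      G.transitionNoise M N e (fun m => X m ω) n s a ∂ℙ = 0 := by
  by_cases hz : ∃ ω₀, (fun m : Fin n => X m ω₀) = z
  · obtain ⟨ω₀, rfl⟩ := hz
    set x : ℕ → Step S A := fun m => X m ω₀ with hx
    have h1 : ∫ ω in {ω | (fun m : Fin n => X m ω) = fun m : Fin n => X m ω₀},
        G.transitionNoise M N e (fun m => X m ω) n s a ∂ℙ =
        ∫ ω in {ω | (fun m : Fin n => X m ω) = fun m : Fin n => X m ω₀},
          (fun y => G.transitionNoise M N e (Function.update x n y) n s a) (X n ω) ∂ℙ := by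
      refine setIntegral_congr_fun (hX.measurableSet_fin_prefix n _) fun ω hω => ?_
      simp only
      rw [G.transitionNoise_congr M N e (y := Function.update x n (X n ω)) fun j hj => ?_]
      rcases (Nat.lt_succ_iff.1 hj).eq_or_lt with rfl | hj'
      · rw [Function.update_self]
      · rw [Function.update_of_ne hj'.ne]
        exact congrFun hω ⟨j, hj'⟩
    rw [h1]
    refine (setIntegral_comp_fintype (hX.meas n) _
      (fun y => G.transitionNoise M N e (Function.update x n y) n s a)).trans ?_
    set p := ℙ.real {ω | ∀ m, m < n → X m ω = x m} with hp
    have h2 : ∀ y, ℙ.real ({ω | X n ω = y} ∩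
        {ω | (fun m : Fin n => X m ω) = fun m : Fin n => X m ω₀}) =
        p * (G.stateProb M x n y.state * G.behaviour M x n y.state y.action *
          M.P y.state y.action y.next * (1 / 2)) := by
      intro y
      have hu : ∀ m, m < n → x m = Function.update x n y m := fun m hm =>
        (Function.update_of_ne hm.ne _ _).symm
      have hn : ∀ m, m < n → (x m).next = (Function.update x n y m).next := fun m hm => by
        rw [← hu m hm]
      have h3 := hX.law n (Function.update x n y)
      rw [Function.update_self, ← G.stateProb_congr hn,
        ← G.behaviour_congr hn fun j hj => hu j (hj.trans_le (episodeStart_le x n))] at h3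
      have h4 : {ω | ∀ m, m < n → X m ω = Function.update x n y m} =
          {ω | ∀ m, m < n → X m ω = x m} := by
        ext ω
        exact forall₂_congr fun m hm => by rw [← hu m hm]
      rw [h4] at h3
      rw [hp, ← h3]
      congr 1
      ext ω
      constructor
      · rintro ⟨h5, h6⟩ m hm
        rcases (Nat.lt_succ_iff.1 hm).eq_or_lt with rfl | hm'
        · rw [Function.update_self]
          exact h5
        · rw [Function.update_of_ne hm'.ne]
          exact congrFun h6 ⟨m, hm'⟩
      · intro h
        refine ⟨?_, ?_⟩
        · have := h n (by omega)
          rwa [Function.update_self] at this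
        · ext1 m
          have := h m (by omega)
          rwa [Function.update_of_ne m.2.ne] at this
    set g := stateValue M (G.lowerIter M N e x n) with hg
    have h5 : ∀ y, G.transitionNoise M N e (Function.update x n y) n s a =
        (if s = y.state ∧ a = y.action then G.rate n (fun m => x m) s a else 0) / 2 *
          (M.γ * (g y.next - ∑ u, M.P s a u * g u)) := by
      intro y
      have hL := G.lowerIter_congr M N e (x := Function.update x n y) (y := x)
        fun j (hj : j < n) => Function.update_of_ne hj.ne _ _
      rw [transitionNoise, hL, stepRate, rateAlong, Function.update_self]
      congr 2
      split_ifs with hsa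
      · rw [← hsa.1, ← hsa.2]
        congr 1
        ext1 m
        exact Function.update_of_ne m.2.ne _ _
      · rfl
    simp only [h2, h5]
    rw [sum_step]
    refine Finset.sum_eq_zero fun s' _ => Finset.sum_eq_zero fun a' _ =>
      Finset.sum_eq_zero fun c _ => ?_
    simp only
    split_ifs with hsa
    · obtain ⟨rfl, rfl⟩ := hsa
      have h6 : ∑ u, M.P s a u * (g u - ∑ v, M.P s a v * g v) = 0 := by
        simp only [sub_eq_add_neg, M.P_sum_add_const, add_neg_cancel]
      refine Eq.trans (Finset.sum_congr rfl fun u _ => ?_)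
        ((Finset.mul_sum _ _ (p * (G.stateProb M x n s * G.behaviour M x n s a * (1 / 2)) *
          (G.rate n (fun m => x m) s a / 2 * M.γ))).symm.trans (by rw [h6, mul_zero]))
      ring
    · simp
  · rw [fiber_eq_empty hz, setIntegral_empty]

lemma ae_tendsto_transitionNoise [IsProbabilityMeasure ℙ] [Nonempty A]
    (hX : G.IsRun M ℙ X) (N : ℕ) {e : ℝ} (he0 : 0 ≤ e) (he1 : e ≤ 1)
    (s : S) (a : A) :
    ∀ᵐ ω ∂ℙ, Summable (fun n => G.stepRate (fun m => X m ω) n s a ^ 2) → ∃ l,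
      Tendsto (fun n => ∑ k ∈ Finset.range n, G.transitionNoise M N e (fun m => X m ω) k s a)
        atTop (nhds l) := by
  have hagree : ∀ n ω ω', (fun m : Fin (n + 1) => X m ω) = (fun m : Fin (n + 1) => X m ω') →
      ∀ j, j < n + 1 → (fun m => X m ω) j = (fun m => X m ω') j :=
    fun n ω ω' h j hj => congrFun h ⟨j, hj⟩
  refine ae_tendsto_of_summable_sq (Z := fun n ω => fun m : Fin n => X m ω)
    (C := G.tableBound M) hX.measurableSet_fin_prefix ?_ ?_ ?_ ?_ ?_ ?_
  · intro n ω ω' h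
    ext1 m
    exact hagree n ω ω' h m (by omega)
  · exact fun n ω ω' h => by rw [G.transitionNoise_congr M N e (hagree n ω ω' h)]
  · exact fun n ω ω' h => by rw [G.stepRate_congr (hagree n ω ω' h)]
  · intro n ω
    have hC := G.tableBound_nonneg M
    have h0 := abs_stateValue_le M hC (G.abs_lowerIter_le M N he0 he1 (fun m => X m ω) n)
    have h1 := abs_le.1 (h0 (X n ω).next)
    have h2 := abs_le.1 (M.abs_P_sum_le s a h0)
    have h3 := G.stepRate_nonneg (fun m => X m ω) n s a
    have h4 : |M.γ * (stateValue M (G.lowerIter M N e (fun m => X m ω) n) (X n ω).next -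
        ∑ u, M.P s a u * stateValue M (G.lowerIter M N e (fun m => X m ω) n) u)| ≤
        2 * G.tableBound M := by
      rw [abs_mul, abs_of_nonneg M.γ_nonneg]
      refine (mul_le_of_le_one_left (abs_nonneg _) M.γ_lt_one.le).trans ?_
      rw [abs_le]
      constructor <;> linarith
    rw [transitionNoise, abs_mul, abs_of_nonneg (by positivity)]
    nlinarith
  · intro n ω
    rw [abs_of_nonneg (G.stepRate_nonneg _ n s a)]
    exact G.stepRate_le_one _ n s a
  · exact fun n z => hX.setIntegral_transitionNoise N e n s a z

variable [IsProbabilityMeasure ℙ] [Nonempty S] [Nonempty A]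

/-- Given the coins of the earlier steps and all else in the episode, the coin is fair. -/
lemma real_coin_eq (hX : G.IsRun M ℙ X) {n e : ℕ} {x : ℕ → Step S A} (hne : n ≤ e)
    (hi : ∀ i, n ≤ i → i < e → (x i).next ∉ M.terminal) (c : Bool) :
    ℙ.real {ω | (X n ω).coin = c ∧ Masked n (e + 1) x fun m => X m ω} =
      ℙ.real {ω | (X n ω).coin = !c ∧ Masked n (e + 1) x fun m => X m ω} := by
  have hp : ∀ c, ∀ y z : ℕ → Step S A, (∀ m, m < e + 1 → y m = z m) →
      ((y n).coin = c ∧ Masked n (e + 1) x y) → (z n).coin = c ∧ Masked n (e + 1) x z :=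
    fun c y z hyz hy => ⟨by rw [← hyz n (by omega), hy.1], hy.2.congr (by omega) hyz⟩
  rw [hX.real_of_prefix (e + 1) (p := fun y => (y n).coin = c ∧ Masked n (e + 1) x y) (hp c),
    hX.real_of_prefix (e + 1) (p := fun y => (y n).coin = !c ∧ Masked n (e + 1) x y) (hp (!c))]
  have hn : n < e + 1 := by omega
  -- Turning over coin `n` is an involution exchanging the two sets of finite paths, and by
  -- `stepProb_flipAt` it preserves every factor of their probabilities.
  refine Finset.sum_nbij' (flipFin n) (flipFin n) ?_ ?_ ?_ ?_ ?_
  · intro q hq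
    simp only [Finset.mem_filter, Finset.mem_univ, true_and] at hq ⊢
    rw [extend_flipFin hn, flipAt_coin, hq.1]
    exact ⟨rfl, masked_flipAt hq.2⟩
  · intro q hq
    simp only [Finset.mem_filter, Finset.mem_univ, true_and] at hq ⊢
    rw [extend_flipFin hn, flipAt_coin, hq.1, Bool.not_not]
    exact ⟨rfl, masked_flipAt hq.2⟩
  · exact fun q _ => flipFin_flipFin hn q
  · exact fun q _ => flipFin_flipFin hn q
  · intro q hq
    simp only [Finset.mem_filter, Finset.mem_univ, true_and] at hq
    refine Finset.prod_congr rfl fun k hk => ?_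
    rw [Finset.mem_range] at hk
    rw [extend_flipFin hn, stepProb_flipAt M G fun i h1 h2 => ?_]
    rw [(strip_eq_iff.1 (hq.2.2 i h1 (by omega))).2.2]
    exact hi i h1 (by omega)

/-- On a fibre only the sign varies. If the episode ends, the fibre is a finite-prefix event on
which both signs have equal mass; otherwise the rate is zero. -/
lemma setIntegral_coinNoise (hX : G.IsRun M ℙ X) (n : ℕ) (s : S) (a : A) (z : List (Step S A)) :
    ∫ ω in {ω | code M n (fun m => X m ω) = z}, G.coinNoise M (fun m => X m ω) n s a ∂ℙ = 0 := by
  by_cases hz : ∃ ω₀, code M n (fun m => X m ω₀) = z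
  · obtain ⟨ω₀, rfl⟩ := hz
    set x : ℕ → Step S A := fun m => X m ω₀ with hx
    set b := G.appliedRate M x n s a / 2 * G.surprise M x n s a with hb
    have h1 : ∫ ω in {ω | code M n (fun m => X m ω) = code M n x},
        G.coinNoise M (fun m => X m ω) n s a ∂ℙ =
        ∫ ω in {ω | code M n (fun m => X m ω) = code M n x},
          (fun c : Bool => (if c then -1 else 1) * b) (X n ω).coin ∂ℙ := by
      refine setIntegral_congr_fun (hX.measurableSet_code n _) fun ω hω => ?_
      simp only [coinNoise]
      rw [(code_eq_iff.1 hω).rate_mul_surprise_eq G]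
    rw [h1]
    by_cases hc : Completed M x n
    · obtain ⟨e, h2, h3, h4⟩ := exists_first hc
      refine (setIntegral_comp_fintype (hX.measurableSet_coin n) _
        (fun c : Bool => (if c then -1 else 1) * b)).trans ?_
      have hm : {ω | Agree M n x fun m => X m ω} = {ω | Masked n (e + 1) x fun m => X m ω} := by
        ext ω
        exact agree_iff_masked h2 h3 h4
      rw [Fintype.sum_bool, hx, fiber_code_eq, ← hx, hm]
      have := hX.real_coin_eq h2 h4 true
      simp only [Bool.not_true] at this
      change ℙ.real {ω | (X n ω).coin = true ∧ Masked n (e + 1) x fun m => X m ω} * _ +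
        ℙ.real {ω | (X n ω).coin = false ∧ Masked n (e + 1) x fun m => X m ω} * _ = 0
      rw [this]
      simp
    · have : b = 0 := by simp [hb, appliedRate, hc]
      simp [this]
  · rw [fiber_eq_empty hz, setIntegral_empty]

lemma ae_tendsto_coinNoise (hX : G.IsRun M ℙ X) (s : S) (a : A) :
    ∀ᵐ ω ∂ℙ, Summable (fun n => G.appliedRate M (fun m => X m ω) n s a ^ 2) → ∃ l,
      Tendsto (fun n => ∑ k ∈ Finset.range n, G.coinNoise M (fun m => X m ω) k s a)
        atTop (nhds l) := by
  refine ae_tendsto_of_summable_sq (Z := fun n ω => code M n fun m => X m ω)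
    (C := 2 * G.tableBound M) hX.measurableSet_code ?_ ?_ ?_ ?_ ?_ ?_
  · exact fun n ω ω' h => code_eq_iff.2 (code_eq_iff.1 h).pred
  · exact fun n ω ω' h => (code_eq_iff.1 h).coinNoise_eq G s a
  · exact fun n ω ω' h => (code_eq_iff.1 h).pred.appliedRate_eq G s a
  · intro n ω
    have h1 := G.abs_surprise_le M (fun m => X m ω) n s a
    have h2 := G.appliedRate_nonneg M (fun m => X m ω) n s a
    have h3 : |(if (X n ω).coin then (-1 : ℝ) else 1)| = 1 := by split_ifs <;> simp
    rw [coinNoise, abs_mul, h3, one_mul, abs_mul, abs_of_nonneg (by positivity)]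
    nlinarith
  · intro n ω
    rw [abs_of_nonneg (G.appliedRate_nonneg M _ n s a)]
    exact G.appliedRate_le_one M _ n s a
  · exact fun n z => hX.setIntegral_coinNoise n s a z

/-- With probability one, the tables end up between the optimal action values and the largest
feasible returns. -/
lemma ae_eventually_tables_mem (hX : G.IsRun M ℙ X)
    (hrate : ∀ᵐ ω ∂ℙ, ∀ s, s ∉ M.terminal → ∀ a,
      ¬ Summable (fun n => G.appliedRate M (fun m => X m ω) n s a) ∧
      Summable (fun n => (G.appliedRate M (fun m => X m ω) n s a) ^ 2)) :
    ∀ᵐ ω ∂ℙ, ∀ δ, 0 < δ → ∀ᶠ n in atTop, ∀ i s, s ∉ M.terminal → ∀ a,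
      M.Qstar s a - δ ≤ G.tables M (fun m => X m ω) n i s a ∧
        G.tables M (fun m => X m ω) n i s a ≤ M.Qmax s a + δ := by
  by_cases hex : ∃ s₀, s₀ ∉ M.terminal
  · obtain ⟨s₀, hs₀⟩ := hex
    obtain ⟨a₀⟩ := ‹Nonempty A›
    have : Nonempty A := ⟨a₀⟩
    have hcoin := ae_all_iff.2 fun s => ae_all_iff.2 fun a => hX.ae_tendsto_coinNoise s a
    have htrans := ae_all_iff.2 fun N => ae_all_iff.2 fun m : ℕ => ae_all_iff.2 fun s =>
      ae_all_iff.2 fun a => hX.ae_tendsto_transitionNoise N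
        (Nat.one_div_pos_of_nat (n := m) (α := ℝ)).le
        (by rw [div_le_one (by positivity)]; linarith [(Nat.cast_nonneg m : (0 : ℝ) ≤ m)]) s a
    filter_upwards [hrate, hX.ae_feasible, hcoin, htrans] with ω h1 h2 h3 h4 δ hδ
    -- An unending episode would make all later applied rates zero, against their divergence at the
    -- nonterminal state `s₀`.
    have hcomp : ∀ n, Completed M (fun m => X m ω) n := by
      intro n
      by_contra hn
      apply (h1 s₀ hs₀ a₀).1
      rw [← summable_nat_add_iff n]
      refine summable_zero.congr fun k => ?_
      have : ¬ Completed M (fun m => X m ω) (k + n) := fun ⟨e, he, ht⟩ =>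
        hn ⟨e, by omega, ht⟩
      simp [appliedRate, this]
    have hreg : Regular M fun m => X m ω := ⟨hcomp, h2.1, h2.2⟩
    refine G.eventually_tables_mem hreg (fun s hs a => (h1 s hs a).1)
      (fun s hs a => h3 s a (h1 s hs a).2) (fun N m s hs a => h4 N m s a ?_) hδ
    refine (h1 s hs a).2.congr fun n => ?_
    rw [G.stepRate_eq_appliedRate M (hcomp n)]
  · refine Eventually.of_forall fun ω δ _ => Eventually.of_forall fun n i s hs => ?_
    exact absurd ⟨s, hs⟩ hex

end IsRun

end Algorithm

end

end GEM

/-! ### From the band of tables to greedy policies. -/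

namespace GEM

variable {S A : Type*} [Fintype S] [Fintype A] {M : EpisodicMDP S A} {μ : ℝ}

/-- Near-optimality of actions up to a small enough error is exact, as there are finitely many
actions. -/
lemma exists_pos_gap (M : EpisodicMDP S A) (μ : ℝ) : ∃ δ, 0 < δ ∧ ∀ s a,
    M.Vstar s ≤ M.Qstar s a + μ + 2 * δ → M.Vstar s ≤ M.Qstar s a + μ := by
  have h : ∀ p : S × A, ∀ᶠ δ in nhdsWithin (0 : ℝ) (Set.Ioi 0),
      M.Vstar p.1 ≤ M.Qstar p.1 p.2 + μ + 2 * δ → M.Vstar p.1 ≤ M.Qstar p.1 p.2 + μ := by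
    intro p
    by_cases hp : M.Vstar p.1 ≤ M.Qstar p.1 p.2 + μ
    · exact Eventually.of_forall fun _ _ => hp
    · push Not at hp
      have hpos : 0 < (M.Vstar p.1 - (M.Qstar p.1 p.2 + μ)) / 2 := by linarith
      filter_upwards [mem_nhdsWithin_of_mem_nhds (gt_mem_nhds hpos)] with δ hδ h'
      change δ < _ at hδ
      linarith
  obtain ⟨δ, h1, h2⟩ := ((eventually_all.2 h).and self_mem_nhdsWithin).exists
  exact ⟨δ, h2, fun s a => h1 (s, a)⟩

/-- A policy that is greedy for a table between the optimal action values and the largest feasible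
returns, up to a small error, is nearly optimal. -/
lemma le_V_of_isGreedy [Nonempty S] [Nonempty A] (hμ : M.NearlyDeterministic μ) {δ : ℝ}
    (hgap : ∀ s a, M.Vstar s ≤ M.Qstar s a + μ + 2 * δ → M.Vstar s ≤ M.Qstar s a + μ)
    {f : S → A → ℝ} (hf : ∀ s, s ∉ M.terminal → ∀ a,
      M.Qstar s a - δ ≤ f s a ∧ f s a ≤ M.Qmax s a + δ)
    {π : Policy S A} (hπ : IsGreedy f π) (s : S) :
    M.Vstar s - 2 * μ / (1 - M.γ) ≤ M.V π s := by
  have hμ0 := hμ.nonneg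
  have h := M.Vstar_sub_le_V π μ (fun s a ha => by
    -- At terminal states the tables are uncontrolled, but there every action is optimal.
    by_cases hs : s ∈ M.terminal
    · rw [M.Qstar_terminal hs, M.Vstar_terminal hs]
      linarith
    · apply hgap
      obtain ⟨b, hb⟩ := M.exists_Qstar_eq_Vstar s
      have h1 := (hf s hs b).1
      have h2 := (hf s hs a).2
      linarith [hπ s a ha b, hμ s a]) s
  -- The argument yields the loss `μ / (1 - γ)`; the stated constant is weaker because `μ` is
  -- nonnegative.
  have h3 : μ / (1 - M.γ) ≤ 2 * μ / (1 - M.γ) :=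
    div_le_div_of_nonneg_right (by linarith) M.one_sub_γ_pos.le
  linarith

end GEM

theorem theorem3 {S A Ω : Type*} [Fintype S] [Fintype A] [Nonempty S] [Nonempty A]
    [MeasurableSpace Ω] (M : GEM.EpisodicMDP S A) (G : GEM.Algorithm S A)
    (ℙ : Measure Ω) [IsProbabilityMeasure ℙ] (X : ℕ → Ω → GEM.Step S A)
    (hX : G.IsRun M ℙ X)
    (hrate : ∀ᵐ ω ∂ℙ, ∀ s, s ∉ M.terminal → ∀ a,
      ¬ Summable (fun n => G.appliedRate M (fun m => X m ω) n s a) ∧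
      Summable (fun n => (G.appliedRate M (fun m => X m ω) n s a) ^ 2))
    (μ : ℝ) (hμ : M.NearlyDeterministic μ) :
    ∀ᵐ ω ∂ℙ,
      (∀ᶠ n in atTop, ∀ (i : Bool) (π : GEM.Policy S A),
        GEM.IsGreedy (G.tables M (fun m => X m ω) n i) π →
        ∀ s, M.Vstar s - 2 * μ / (1 - M.γ) ≤ M.V π s) ∧
      (∀ (i : Bool) (Q : S → A → ℝ),
        MapClusterPt Q atTop (fun n => G.tables M (fun m => X m ω) n i) →
        ∀ π : GEM.Policy S A, GEM.IsGreedy Q π →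
        ∀ s, M.Vstar s - 2 * μ / (1 - M.γ) ≤ M.V π s) := by
  obtain ⟨δ, hδ, hgap⟩ := GEM.exists_pos_gap M μ
  filter_upwards [hX.ae_eventually_tables_mem hrate] with ω hω
  have hev := hω δ hδ
  constructor
  · filter_upwards [hev] with n hn i π hπ s
    exact GEM.le_V_of_isGreedy hμ hgap (fun s hs a => hn i s hs a) hπ s
  · intro i Q hQ π hπ s
    -- The band is closed, so limit points inherit it with the same `δ`.
    have hclosed : IsClosed {f : S → A → ℝ | ∀ s, s ∉ M.terminal → ∀ a,
        f s a ∈ Set.Icc (M.Qstar s a - δ) (M.Qmax s a + δ)} := by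
      simp only [Set.ofPred_forall]
      exact isClosed_iInter fun s => isClosed_iInter fun _ => isClosed_iInter fun a =>
        isClosed_Icc.preimage (by fun_prop)
    exact GEM.le_V_of_isGreedy hμ hgap
      (hclosed.mem_of_mapClusterPt hQ (hev.mono fun n hn s hs a => hn i s hs a)) hπ s
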